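/- Let $n\ge 0$, let $\square=[-1,1]^{n+1}\subset\mathbb{R}^{n+1}$, and let $\Sigma_\square$ be its normal fan, whose cones are the normal cones of the nonempty faces of $\square$. Let $\mathbb{T}\Sigma_\square$ be the tropical toric variety of $\Sigma_\square$, with its stratification into cells indexed by the cones $\rho\in\Sigma_\square$ (the cell of $\rho$ lies in the closure of the cell of $\rho'$ if and only if $\rho'\subseteq\rho$). Let $\mathcal{F}^p$ be the sheaf on this poset of cells given by $\mathcal{F}^p(\rho)=\bigwedge^p\rho^\perp$, where $\rho^\perp\subset\mathbb{Z}^{n+1}$ is the sublattice of integral vectors orthogonal to $\rho$, with the maps $\mathcal{F}^p(\rho)\to\mathcal{F}^p(\rho')$ for $\rho'\subseteq\rho$ induced by $\rho^\perp\subseteq\rho'^\perp$. Let $\cup$ be the cup product on the cohomology of the sheaves $\mathcal{F}^p\otimes\mathbb{F}_2$ induced by the exterior product. Then the map $$Sq:\ H^1(\mathbb{T}\Sigma_\square,\mathcal{F}^1\otimes\mathbb{F}_2)\to H^2(\mathbb{T}\Sigma_\square,\mathcal{F}^2\otimes\mathbb{F}_2),\qquad \beta\mapsto\beta\cup\beta,$$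 is identically zero. Moreover, for any non-zero $D\in H^1(\mathbb{T}\Sigma_\square,\mathcal{F}^1\otimes\mathbb{F}_2)$, the $\mathbb{F}_2$-linear map $$\cup_D:\ H^1(\mathbb{T}\Sigma_\square,\mathcal{F}^1\otimes\mathbb{F}_2)\to H^2(\mathbb{T}\Sigma_\square,\mathcal{F}^2\otimes\mathbb{F}_2),\qquad \beta\mapsto\beta\cup D,$$ has kernel generated by $D$ and rank $n$. -/

import Mathlib

open scoped TensorProduct

noncomputable section

namespace TropicalCube

/-! ### Sheaves on posets, their cohomology and the cup product -/

/-- A sheaf of `k`-modules on a poset `P` (a covariant functor): for a cell complex with face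
poset `P` this is a cellular sheaf, with maps from the faces of a cell to the cell. -/
structure PosetSheaf (k : Type*) [CommRing k] (P : Type*) [PartialOrder P] where
  obj : P → Type
  [addCommGroup : ∀ x, AddCommGroup (obj x)]
  [module : ∀ x, Module k (obj x)]
  map : ∀ {x y : P}, x ≤ y → obj x →ₗ[k] obj y
  map_id : ∀ x : P, map (le_refl x) = LinearMap.id
  map_comp : ∀ {x y z : P} (h : x ≤ y) (h' : y ≤ z), map h' ∘ₗ map h = map (h.trans h')

attribute [instance] PosetSheaf.addCommGroup PosetSheaf.module

section Cohomology

variable {k : Type*} [CommRing k] {P : Type*} [PartialOrder P]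

/-- The `q`-simplices `x₀ < x₁ < ⋯ < x_q` of the order complex of `P`. -/
abbrev Chain (P : Type*) [PartialOrder P] (q : ℕ) : Type _ := Fin (q + 1) ↪o P

/-- The face of a chain that omits its `i`-th element. -/
def Chain.face {q : ℕ} (c : Chain P (q + 1)) (i : Fin (q + 2)) : Chain P q :=
  (Fin.succAboveOrderEmb i).trans c

/-- The front face `x₀ < ⋯ < x_p` of a chain `x₀ < ⋯ < x_{p+q}`. -/
def Chain.front {p q : ℕ} (c : Chain P (p + q)) : Chain P p :=
  (Fin.castLEOrderEmb (by omega : p + 1 ≤ p + q + 1)).trans c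

/-- The back face `x_p < ⋯ < x_{p+q}` of a chain `x₀ < ⋯ < x_{p+q}`. -/
def Chain.back {p q : ℕ} (c : Chain P (p + q)) : Chain P q :=
  (Fin.natAddOrderEmb p : Fin (q + 1) ↪o Fin (p + (q + 1))).trans c

theorem Chain.face_last_le {q : ℕ} (c : Chain P (q + 1)) (i : Fin (q + 2)) :
    c.face i (Fin.last q) ≤ c (Fin.last (q + 1)) :=
  c.monotone (Fin.le_last _)

theorem Chain.front_last_le {p q : ℕ} (c : Chain P (p + q)) :
    (c.front : Chain P p) (Fin.last p) ≤ c (Fin.last (p + q)) :=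
  c.monotone (Fin.le_last _)

theorem Chain.back_last_le {p q : ℕ} (c : Chain P (p + q)) :
    (c.back : Chain P q) (Fin.last q) ≤ c (Fin.last (p + q)) :=
  c.monotone (Fin.le_last _)

/-- Simplicial `q`-cochains on the order complex with values in `F`.  The open simplex
`x₀ < ⋯ < x_q` of the barycentric subdivision lies in the open cell `x_q`. -/
abbrev Cochain (F : PosetSheaf k P) (q : ℕ) : Type _ :=
  ∀ c : Chain P q, F.obj (c (Fin.last q))

/-- The simplicial coboundary. -/
def coboundary (F : PosetSheaf k P) (q : ℕ) : Cochain F q →ₗ[k] Cochain F (q + 1) :=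
  LinearMap.pi fun c => ∑ i : Fin (q + 2),
    (-1 : k) ^ (i : ℕ) •
      (F.map (c.face_last_le i) ∘ₗ LinearMap.proj (c.face i))

/-- The `q`-cocycles. -/
def cocycles (F : PosetSheaf k P) (q : ℕ) : Submodule k (Cochain F q) :=
  LinearMap.ker (coboundary F q)

/-- The `q`-coboundaries. -/
def coboundaries (F : PosetSheaf k P) : (q : ℕ) → Submodule k (Cochain F q)
  | 0 => ⊥
  | q + 1 => LinearMap.range (coboundary F q)

/-- The cohomology `H^q(P; F)`. -/
abbrev Cohomology (F : PosetSheaf k P) (q : ℕ) : Type _ :=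
  cocycles F q ⧸ (coboundaries F q).comap (cocycles F q).subtype

/-- A bilinear pairing of sheaves `F × G → E`, compatible with the sheaf maps. -/
structure Pairing (F G E : PosetSheaf k P) where
  app : ∀ x : P, F.obj x →ₗ[k] G.obj x →ₗ[k] E.obj x
  naturality : ∀ {x y : P} (h : x ≤ y) (a : F.obj x) (b : G.obj x),
    E.map h (app x a b) = app y (F.map h a) (G.map h b)

variable {F G E : PosetSheaf k P}

/-- The (Alexander–Whitney) cup product of cochains:
`(a ∪ b)(x₀ < ⋯ < x_{p+q}) = a(x₀ < ⋯ < x_p)|_{x_{p+q}} · b(x_p < ⋯ < x_{p+q})`. -/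
def cochainCup (μ : Pairing F G E) (p q : ℕ) :
    Cochain F p →ₗ[k] Cochain G q →ₗ[k] Cochain E (p + q) :=
  LinearMap.mk₂ k
    (fun a b c => μ.app (c (Fin.last (p + q)))
      (F.map c.front_last_le (a c.front)) (G.map c.back_last_le (b c.back)))
    (by intro a a' b; funext c; simp only [Pi.add_apply, map_add, LinearMap.add_apply])
    (by intro r a b; funext c; simp only [Pi.smul_apply, map_smul, LinearMap.smul_apply])
    (by intro a b b'; funext c; simp only [Pi.add_apply, map_add])
    (by intro r a b; funext c; simp only [Pi.smul_apply, map_smul])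

theorem PosetSheaf.map_map (F : PosetSheaf k P) {x y z : P} (h : x ≤ y) (h' : y ≤ z)
    (a : F.obj x) : F.map h' (F.map h a) = F.map (h.trans h') a := by
  rw [← F.map_comp h h']; rfl

theorem coboundary_apply (F : PosetSheaf k P) (q : ℕ) (a : Cochain F q) (c : Chain P (q + 1)) :
    coboundary F q a c = ∑ i : Fin (q + 2),
      (-1 : k) ^ (i : ℕ) • F.map (c.face_last_le i) (a (c.face i)) := by
  simp only [coboundary, LinearMap.pi_apply, LinearMap.sum_apply, LinearMap.smul_apply,
    LinearMap.comp_apply, LinearMap.proj_apply]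

theorem coboundary_zero_apply (F : PosetSheaf k P) (s : Cochain F 0) (c : Chain P 1) :
    coboundary F 0 s c =
      F.map (c.face_last_le 0) (s (c.face 0)) - F.map (c.face_last_le 1) (s (c.face 1)) := by
  rw [coboundary_apply, Fin.sum_univ_two]
  simp [sub_eq_add_neg]

theorem cochainCup_apply (μ : Pairing F G E) (p q : ℕ) (a : Cochain F p) (b : Cochain G q)
    (c : Chain P (p + q)) :
    cochainCup μ p q a b c = μ.app (c (Fin.last (p + q)))
      (F.map c.front_last_le (a c.front)) (G.map c.back_last_le (b c.back)) := rfl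

theorem map_congr_chain (F : PosetSheaf k P) {q : ℕ} (a : Cochain F q) {c c' : Chain P q}
    (hc : c = c') {y : P} (h : c (Fin.last q) ≤ y) (h' : c' (Fin.last q) ≤ y) :
    F.map h (a c) = F.map h' (a c') := by
  subst hc; rfl

/-- The restriction to `y` of the cocycle condition for a `1`-cochain. -/
theorem cocycle_one (F : PosetSheaf k P) {a : Cochain F 1} {c : Chain P 2}
    (ha : coboundary F 1 a = 0) {y : P} (h0 : c.face 0 (Fin.last 1) ≤ y)
    (h1 : c.face 1 (Fin.last 1) ≤ y) (h2 : c.face 2 (Fin.last 1) ≤ y)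
    (h : c (Fin.last 2) ≤ y) :
    F.map h1 (a (c.face 1)) = F.map h0 (a (c.face 0)) + F.map h2 (a (c.face 2)) := by
  have e := congrArg (F.map h) (congrFun ha c)
  rw [coboundary_apply, Fin.sum_univ_three] at e
  simp only [map_add, map_smul, F.map_map, Pi.zero_apply, map_zero] at e
  simp at e
  rw [← sub_eq_zero, ← neg_eq_zero, ← e]
  abel

theorem coboundary_cup_eq_zero (μ : Pairing F G E) {a : Cochain F 1} {b : Cochain G 1}
    (ha : coboundary F 1 a = 0) (hb : coboundary G 1 b = 0) :
    coboundary E 2 (cochainCup μ 1 1 a b) = 0 := by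
  funext c
  rw [coboundary_apply, Fin.sum_univ_four]
  simp only [cochainCup_apply, μ.naturality, PosetSheaf.map_map]
  let f : Chain P 2 := Chain.front (p := 2) (q := 1) c
  let g : Chain P 2 := Chain.back (p := 1) (q := 2) c
  have hf : ∀ i, f.face i (Fin.last 1) ≤ c (Fin.last 3) := fun i => c.monotone (Fin.le_last _)
  have hg : ∀ i, g.face i (Fin.last 1) ≤ c (Fin.last 3) := fun i => c.monotone (Fin.le_last _)
  have f0 : Chain.front (p := 1) (q := 1) (c.face 0) = f.face 0 := by
    ext i; fin_cases i <;> rfl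
  have f1 : Chain.front (p := 1) (q := 1) (c.face 1) = f.face 1 := by
    ext i; fin_cases i <;> rfl
  have f2 : Chain.front (p := 1) (q := 1) (c.face 2) = f.face 2 := by
    ext i; fin_cases i <;> rfl
  have f3 : Chain.front (p := 1) (q := 1) (c.face 3) = f.face 2 := by
    ext i; fin_cases i <;> rfl
  have g0 : Chain.back (p := 1) (q := 1) (c.face 0) = g.face 0 := by
    ext i; fin_cases i <;> rfl
  have g1 : Chain.back (p := 1) (q := 1) (c.face 1) = g.face 0 := by
    ext i; fin_cases i <;> rfl
  have g2 : Chain.back (p := 1) (q := 1) (c.face 2) = g.face 1 := by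
    ext i; fin_cases i <;> rfl
  have g3 : Chain.back (p := 1) (q := 1) (c.face 3) = g.face 2 := by
    ext i; fin_cases i <;> rfl
  rw [map_congr_chain F a f0 _ (hf 0), map_congr_chain F a f1 _ (hf 1),
    map_congr_chain F a f2 _ (hf 2), map_congr_chain F a f3 _ (hf 2),
    map_congr_chain G b g0 _ (hg 0), map_congr_chain G b g1 _ (hg 0),
    map_congr_chain G b g2 _ (hg 1), map_congr_chain G b g3 _ (hg 2),
    cocycle_one F ha (hf 0) (hf 1) (hf 2) (c.monotone (Fin.le_last _)),
    cocycle_one G hb (hg 0) (hg 1) (hg 2) (c.monotone (Fin.le_last _))]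
  simp [pow_succ]

theorem coboundary_cup (μ : Pairing F G E) (s : Cochain F 0) {b : Cochain G 1}
    (hb : coboundary G 1 b = 0) :
    cochainCup μ 1 1 (coboundary F 0 s) b = coboundary E 1 (cochainCup μ 0 1 s b) := by
  funext c
  rw [coboundary_apply, Fin.sum_univ_three]
  simp only [cochainCup_apply, μ.naturality, PosetSheaf.map_map, coboundary_zero_apply,
    map_sub]
  have hf : ∀ i j, (c.face i).face j (Fin.last 0) ≤ c (Fin.last 2) :=
    fun i j => c.monotone (Fin.le_last _)
  have hg : ∀ i, c.face i (Fin.last 1) ≤ c (Fin.last 2) := fun i => c.monotone (Fin.le_last _)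
  have f0 : (Chain.front (p := 1) (q := 1) c).face 0 = (c.face 0).face 1 := by
    ext i; fin_cases i; rfl
  have f1 : (Chain.front (p := 1) (q := 1) c).face 1 = (c.face 1).face 1 := by
    ext i; fin_cases i; rfl
  have f2 : Chain.front (p := 0) (q := 1) (c.face 0) = (c.face 0).face 1 := by
    ext i; fin_cases i; rfl
  have f3 : Chain.front (p := 0) (q := 1) (c.face 1) = (c.face 1).face 1 := by
    ext i; fin_cases i; rfl
  have f4 : Chain.front (p := 0) (q := 1) (c.face 2) = (c.face 1).face 1 := by
    ext i; fin_cases i; rfl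
  have g0 : Chain.back (p := 1) (q := 1) c = c.face 0 := by ext i; fin_cases i <;> rfl
  have g1 : Chain.back (p := 0) (q := 1) (c.face 0) = c.face 0 := by ext i; fin_cases i <;> rfl
  have g2 : Chain.back (p := 0) (q := 1) (c.face 1) = c.face 1 := by ext i; fin_cases i <;> rfl
  have g3 : Chain.back (p := 0) (q := 1) (c.face 2) = c.face 2 := by ext i; fin_cases i <;> rfl
  rw [map_congr_chain F s f0 _ (hf 0 1), map_congr_chain F s f1 _ (hf 1 1),
    map_congr_chain F s f2 _ (hf 0 1), map_congr_chain F s f3 _ (hf 1 1),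
    map_congr_chain F s f4 _ (hf 1 1), map_congr_chain G b g0 _ (hg 0),
    map_congr_chain G b g1 _ (hg 0), map_congr_chain G b g2 _ (hg 1),
    map_congr_chain G b g3 _ (hg 2),
    cocycle_one G hb (hg 0) (hg 1) (hg 2) (c.monotone (Fin.le_last _))]
  simp
  abel

theorem cup_coboundary (μ : Pairing F G E) {a : Cochain F 1} (s : Cochain G 0)
    (ha : coboundary F 1 a = 0) :
    cochainCup μ 1 1 a (coboundary G 0 s) = coboundary E 1 (-cochainCup μ 1 0 a s) := by
  funext c
  rw [map_neg, Pi.neg_apply, coboundary_apply, Fin.sum_univ_three]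
  simp only [cochainCup_apply, μ.naturality, PosetSheaf.map_map, coboundary_zero_apply,
    map_sub]
  have hg : ∀ i j, (c.face i).face j (Fin.last 0) ≤ c (Fin.last 2) :=
    fun i j => c.monotone (Fin.le_last _)
  have hf : ∀ i, c.face i (Fin.last 1) ≤ c (Fin.last 2) := fun i => c.monotone (Fin.le_last _)
  have g0 : (Chain.back (p := 1) (q := 1) c).face 0 = (c.face 0).face 0 := by
    ext i; fin_cases i; rfl
  have g1 : (Chain.back (p := 1) (q := 1) c).face 1 = (c.face 2).face 0 := by
    ext i; fin_cases i; rfl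
  have g2 : Chain.back (p := 1) (q := 0) (c.face 0) = (c.face 0).face 0 := by
    ext i; fin_cases i; rfl
  have g3 : Chain.back (p := 1) (q := 0) (c.face 1) = (c.face 0).face 0 := by
    ext i; fin_cases i; rfl
  have g4 : Chain.back (p := 1) (q := 0) (c.face 2) = (c.face 2).face 0 := by
    ext i; fin_cases i; rfl
  have f0 : Chain.front (p := 1) (q := 1) c = c.face 2 := by ext i; fin_cases i <;> rfl
  have f1 : Chain.front (p := 1) (q := 0) (c.face 0) = c.face 0 := by ext i; fin_cases i <;> rfl
  have f2 : Chain.front (p := 1) (q := 0) (c.face 1) = c.face 1 := by ext i; fin_cases i <;> rfl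
  have f3 : Chain.front (p := 1) (q := 0) (c.face 2) = c.face 2 := by ext i; fin_cases i <;> rfl
  rw [map_congr_chain G s g0 _ (hg 0 0), map_congr_chain G s g1 _ (hg 2 0),
    map_congr_chain G s g2 _ (hg 0 0), map_congr_chain G s g3 _ (hg 0 0),
    map_congr_chain G s g4 _ (hg 2 0), map_congr_chain F a f0 _ (hf 2),
    map_congr_chain F a f1 _ (hf 0), map_congr_chain F a f2 _ (hf 1),
    map_congr_chain F a f3 _ (hf 2),
    cocycle_one F ha (hf 0) (hf 1) (hf 2) (c.monotone (Fin.le_last _))]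
  simp
  abel

/-- The cup product of cocycles, as a map to cohomology. -/
def cocycleCup (μ : Pairing F G E) :
    cocycles F 1 →ₗ[k] cocycles G 1 →ₗ[k] Cohomology E 2 :=
  LinearMap.mk₂ k
    (fun a b => Submodule.Quotient.mk
      ⟨cochainCup μ 1 1 a.1 b.1, coboundary_cup_eq_zero μ a.2 b.2⟩)
    (by
      intro a a' b
      rw [← Submodule.Quotient.mk_add]
      congr 1; ext1; simp)
    (by
      intro r a b
      rw [← Submodule.Quotient.mk_smul]
      congr 1; ext1; simp)
    (by
      intro a b b'
      rw [← Submodule.Quotient.mk_add]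
      congr 1; ext1; simp)
    (by
      intro r a b
      rw [← Submodule.Quotient.mk_smul]
      congr 1; ext1; simp)

/-- The cup product `H¹(P; F) × H¹(P; G) → H²(P; E)` induced by a pairing `F × G → E`. -/
def cup (μ : Pairing F G E) : Cohomology F 1 →ₗ[k] Cohomology G 1 →ₗ[k] Cohomology E 2 :=
  Submodule.liftQ _
    (LinearMap.flip (Submodule.liftQ _ (cocycleCup μ).flip (by
      rintro ⟨b, hb⟩ ⟨s, rfl⟩
      ext a
      refine (Submodule.Quotient.mk_eq_zero _).2 ⟨-cochainCup μ 1 0 a.1 s, ?_⟩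
      exact (cup_coboundary μ s a.2).symm)))
    (by
      rintro ⟨a, ha⟩ ⟨s, rfl⟩
      ext b
      refine (Submodule.Quotient.mk_eq_zero _).2 ⟨cochainCup μ 0 1 s b.1, ?_⟩
      exact (coboundary_cup μ s b.2).symm)

/-- On representing cocycles, `cup` is the cochain cup product. -/
theorem cup_mk (μ : Pairing F G E) (a : cocycles F 1) (b : cocycles G 1) :
    cup μ (Submodule.Quotient.mk a) (Submodule.Quotient.mk b) =
      Submodule.Quotient.mk
        ⟨cochainCup μ 1 1 a.1 b.1, coboundary_cup_eq_zero μ a.2 b.2⟩ := rfl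

end Cohomology

/-! ### Normal fans and tropical toric varieties -/

section Fan

variable {d : ℕ}

/-- The cone of (outer) normal vectors to the polytope `Δ` along its face `A`. -/
def normalCone (Δ A : Set (Fin d → ℝ)) : PointedCone ℝ (Fin d → ℝ) where
  carrier := {v | ∀ u ∈ A, ∀ w ∈ Δ, w ⬝ᵥ v ≤ u ⬝ᵥ v}
  add_mem' := by
    intro v v' hv hv' u hu w hw
    rw [dotProduct_add, dotProduct_add]
    exact add_le_add (hv u hu w hw) (hv' u hu w hw)
  zero_mem' := by intro u _ w _; simp
  smul_mem' := by
    intro r v hv u hu w hw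
    have h := mul_le_mul_of_nonneg_left (hv u hu w hw) r.2
    rw [Nonneg.mk_smul, dotProduct_smul, dotProduct_smul]
    exact h

/-- The normal fan `Σ_Δ` of a polytope `Δ`: the normal cones to its nonempty faces. -/
def normalFan (Δ : Set (Fin d → ℝ)) : Set (PointedCone ℝ (Fin d → ℝ)) :=
  {ρ | ∃ A : Set (Fin d → ℝ), A.Nonempty ∧ IsExposed ℝ Δ A ∧ ρ = normalCone Δ A}

/-- The face poset of the tropical toric variety `𝕋Σ` of a fan `Σ`: the cell of a cone `ρ`
is `N_ℝ / ⟨ρ⟩`, and it lies in the closure of the cell of `ρ'` iff `ρ' ⊆ ρ`, so the order is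
the inverse of inclusion. -/
abbrev CellPoset (S : Set (PointedCone ℝ (Fin d → ℝ))) : Type := (S)ᵒᵈ

/-- The cone of a cell. -/
def CellPoset.cone {S : Set (PointedCone ℝ (Fin d → ℝ))} (x : CellPoset S) :
    PointedCone ℝ (Fin d → ℝ) := (OrderDual.ofDual x).1

/-- The sublattice `ρ^⊥` of `ℤ^d` orthogonal to the cone `ρ`. -/
def perp (ρ : PointedCone ℝ (Fin d → ℝ)) : Submodule ℤ (Fin d → ℤ) where
  carrier := {m | ∀ v ∈ ρ, (fun i => (m i : ℝ)) ⬝ᵥ v = 0}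
  add_mem' := by
    intro m m' hm hm' v hv
    have h := hm v hv
    have h' := hm' v hv
    simp only [dotProduct, Pi.add_apply, Int.cast_add, add_mul, Finset.sum_add_distrib] at *
    rw [h, h', add_zero]
  zero_mem' := by intro v _; simp [dotProduct]
  smul_mem' := by
    intro r m hm v hv
    have h := hm v hv
    simp only [dotProduct, Pi.smul_apply, smul_eq_mul, Int.cast_mul, mul_assoc,
      ← Finset.mul_sum] at *
    rw [h, mul_zero]

theorem perp_anti {ρ ρ' : PointedCone ℝ (Fin d → ℝ)} (h : ρ' ≤ ρ) : perp ρ ≤ perp ρ' :=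
  fun _ hm v hv => hm v (h hv)

/-- The map `𝔽₂ ⊗ ⋀^p L → 𝔽₂ ⊗ ⋀^p L'` induced by an inclusion of lattices `L ⊆ L'`. -/
def inclusionMap (p : ℕ) {L L' : Submodule ℤ (Fin d → ℤ)} (h : L ≤ L') :
    ZMod 2 ⊗[ℤ] ⋀[ℤ]^p L →ₗ[ZMod 2] ZMod 2 ⊗[ℤ] ⋀[ℤ]^p L' :=
  (exteriorPower.map p (Submodule.inclusion h)).baseChange (ZMod 2)

theorem inclusionMap_id (p : ℕ) (L : Submodule ℤ (Fin d → ℤ)) :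
    inclusionMap p (le_refl L) = LinearMap.id := by
  have h : Submodule.inclusion (le_refl L) = LinearMap.id := rfl
  rw [inclusionMap, h, exteriorPower.map_id, LinearMap.baseChange_id]

theorem inclusionMap_comp (p : ℕ) {L L' L'' : Submodule ℤ (Fin d → ℤ)} (h : L ≤ L')
    (h' : L' ≤ L'') : inclusionMap p h' ∘ₗ inclusionMap p h = inclusionMap p (h.trans h') := by
  rw [inclusionMap, inclusionMap, ← LinearMap.baseChange_comp, ← exteriorPower.map_comp]
  rfl

/-- The sheaf `𝓕^p ⊗ 𝔽₂` on `𝕋Σ`, with `𝓕^p(ρ) = ⋀^p ρ^⊥` and the sheaf maps induced by the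
inclusions `ρ^⊥ ⊆ ρ'^⊥` for `ρ' ⊆ ρ`. -/
def multitangentSheaf (S : Set (PointedCone ℝ (Fin d → ℝ))) (p : ℕ) :
    PosetSheaf (ZMod 2) (CellPoset S) where
  obj x := ZMod 2 ⊗[ℤ] ⋀[ℤ]^p (perp x.cone)
  map {x y} h := inclusionMap p (perp_anti (show y.cone ≤ x.cone from h))
  map_id x := inclusionMap_id p (perp x.cone)
  map_comp _ _ := inclusionMap_comp p _ _

/-- The exterior product `⋀^p L × ⋀^q L → ⋀^{p+q} L`. -/
def wedge (L : Type*) [AddCommGroup L] (p q : ℕ) :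
    ⋀[ℤ]^p L →ₗ[ℤ] ⋀[ℤ]^q L →ₗ[ℤ] ⋀[ℤ]^(p + q) L :=
  LinearMap.mk₂ ℤ (fun a b => ⟨a.1 * b.1, SetLike.mul_mem_graded a.2 b.2⟩)
    (by intro a a' b; ext1; simp [add_mul])
    (by intro r a b; ext1; simp [mul_assoc])
    (by intro a b b'; ext1; simp [mul_add])
    (by intro r a b; ext1; exact mul_smul_comm r a.1 b.1)

/-- The exterior product modulo `2`: `(s ⊗ a) ∧ (t ⊗ b) = s t ⊗ (a ∧ b)`. -/
def wedgeModTwo (L : Type*) [AddCommGroup L] (p q : ℕ) :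
    ZMod 2 ⊗[ℤ] ⋀[ℤ]^p L →ₗ[ZMod 2] ZMod 2 ⊗[ℤ] ⋀[ℤ]^q L →ₗ[ZMod 2]
      ZMod 2 ⊗[ℤ] ⋀[ℤ]^(p + q) L :=
  LinearMap.liftBaseChange (ZMod 2)
    (LinearMap.baseChangeHom ℤ (ZMod 2) (⋀[ℤ]^q L) (⋀[ℤ]^(p + q) L) ∘ₗ wedge L p q)

theorem wedgeModTwo_tmul (L : Type*) [AddCommGroup L] (p q : ℕ) (s t : ZMod 2)
    (a : ⋀[ℤ]^p L) (b : ⋀[ℤ]^q L) :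
    wedgeModTwo L p q (s ⊗ₜ a) (t ⊗ₜ b) = (s * t) ⊗ₜ wedge L p q a b := by
  simp [wedgeModTwo, TensorProduct.smul_tmul']

theorem coe_exteriorPower_map {L L' : Type*} [AddCommGroup L] [AddCommGroup L'] (p : ℕ)
    (f : L →ₗ[ℤ] L') (a : ⋀[ℤ]^p L) :
    (exteriorPower.map p f a : ExteriorAlgebra ℤ L') = ExteriorAlgebra.map f a.1 := by
  have h : (⋀[ℤ]^p L').subtype ∘ₗ exteriorPower.map p f =
      (ExteriorAlgebra.map f).toLinearMap ∘ₗ (⋀[ℤ]^p L).subtype := by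
    apply exteriorPower.linearMap_ext
    ext m
    simp [ExteriorAlgebra.map_apply_ιMulti]
  exact LinearMap.congr_fun h a

theorem wedge_map (p q : ℕ) {L L' : Submodule ℤ (Fin d → ℤ)} (h : L ≤ L')
    (a : ⋀[ℤ]^p L) (b : ⋀[ℤ]^q L) :
    exteriorPower.map (p + q) (Submodule.inclusion h) (wedge L p q a b) =
      wedge L' p q (exteriorPower.map p (Submodule.inclusion h) a)
        (exteriorPower.map q (Submodule.inclusion h) b) := by
  apply Subtype.ext
  have e := map_mul (ExteriorAlgebra.map (Submodule.inclusion h)) a.1 b.1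
  rw [← coe_exteriorPower_map, ← coe_exteriorPower_map] at e
  rw [coe_exteriorPower_map]
  exact e

theorem wedgeModTwo_inclusionMap (p q : ℕ) {L L' : Submodule ℤ (Fin d → ℤ)} (h : L ≤ L')
    (a : ZMod 2 ⊗[ℤ] ⋀[ℤ]^p L) (b : ZMod 2 ⊗[ℤ] ⋀[ℤ]^q L) :
    inclusionMap (p + q) h (wedgeModTwo L p q a b) =
      wedgeModTwo L' p q (inclusionMap p h a) (inclusionMap q h b) := by
  induction a using TensorProduct.induction_on with
  | zero => simp
  | add a a' ha ha' => simp only [map_add, LinearMap.add_apply, ha, ha']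
  | tmul s a =>
    induction b using TensorProduct.induction_on with
    | zero => simp
    | add b b' hb hb' => simp only [map_add, hb, hb']
    | tmul t b =>
      simp only [inclusionMap, wedgeModTwo_tmul, LinearMap.baseChange_tmul, wedge_map]

/-- The pairing `(𝓕^p ⊗ 𝔽₂) × (𝓕^q ⊗ 𝔽₂) → 𝓕^{p+q} ⊗ 𝔽₂` given by the exterior product. -/
def wedgePairing (S : Set (PointedCone ℝ (Fin d → ℝ))) (p q : ℕ) :
    Pairing (multitangentSheaf S p) (multitangentSheaf S q) (multitangentSheaf S (p + q)) where
  app x := wedgeModTwo (perp x.cone) p q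
  naturality _ a b := wedgeModTwo_inclusionMap p q _ a b

/-- `H^q(𝕋Σ, 𝓕^p ⊗ 𝔽₂)`. -/
abbrev tropicalCohomology (S : Set (PointedCone ℝ (Fin d → ℝ))) (q p : ℕ) : Type _ :=
  Cohomology (multitangentSheaf S p) q

/-- The cup product
`H¹(𝕋Σ, 𝓕¹ ⊗ 𝔽₂) × H¹(𝕋Σ, 𝓕¹ ⊗ 𝔽₂) → H²(𝕋Σ, 𝓕² ⊗ 𝔽₂)`. -/
def tropicalCup (S : Set (PointedCone ℝ (Fin d → ℝ))) :
    tropicalCohomology S 1 1 →ₗ[ZMod 2] tropicalCohomology S 1 1 →ₗ[ZMod 2]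
      tropicalCohomology S 2 2 :=
  cup (wedgePairing S 1 1)

/-- The cube `□ = [-1,1]^d`. -/
def cube (d : ℕ) : Set (Fin d → ℝ) := Set.Icc (-1) 1

/-- The normal fan `Σ_□` of the cube. -/
def cubeFan (d : ℕ) : Set (PointedCone ℝ (Fin d → ℝ)) := normalFan (cube d)

end Fan

end TropicalCube

end

open scoped TensorProduct

noncomputable section

namespace TropicalCube

/-! ### Coordinates on the exterior powers of a coordinate sublattice -/

section Coordinates

variable {d : ℕ}

/-! The cones of the normal fan of the cube are spanned by vectors `±e_i`, never by both signs of
the same `e_i`. Hence every `ρ^⊥` is spanned by standard basis vectors, and a single basis of `ℤ^d`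
is adapted to all stalks at once. Everything rests on this.

Squares vanish: modulo 2 the exterior product is the polarisation of `Q(∑ aᵢ eᵢ) = ∑_{i<j} aᵢ aⱼ eᵢ
∧ eⱼ`, and `Q` commutes with the sheaf maps because these preserve coordinates. Applying `Q` to the
values of a cocycle `a` gives a cochain whose coboundary is `a ∪ a` (`cup_self_eq_coboundary`).

The group `H¹`: the open cell, that of the zero cone, is the top of the poset, so in coordinates a
cocycle is the difference of a potential, its value on `x < 0`. The `i`-th coordinate of the
potential is constant on the cells whose cone contains a given ray `±e_i`. Comparing the two rays
gives the `i`-th period; the periods identify `H¹` with `𝔽₂^d` (`cohomologyPeriod_bijective`).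

The kernel: if `a ∪ b` is a coboundary, summing the `e_i ∧ e_j` coefficients over the eight flags
vertex < ray < 0 in the `(i, j)`-plane shows that the 2×2 minor of the periods of `a` and `b` in
columns `i, j` is zero (`period_mul_add_eq_zero`). When all minors vanish and `b` is not a
coboundary, the class of `a` is a multiple of that of `b`. Conversely `D ∪ D = 0`, so the kernel is
the line through `D`, and the rank is `(n + 1) - 1`. -/

/-- A sublattice of `ℤ^d` spanned by some of the standard basis vectors. -/
def IsCoordinate (L : Submodule ℤ (Fin d → ℤ)) : Prop :=
  ∀ m ∈ L, ∀ i, m i ≠ 0 → Pi.single i 1 ∈ L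

open Classical in
/-- The `i`-th standard basis vector if it lies in `L`, and zero otherwise. -/
def basisVec (L : Submodule ℤ (Fin d → ℤ)) (i : Fin d) : L :=
  if h : Pi.single i 1 ∈ L then ⟨Pi.single i 1, h⟩ else 0

/-- The default `0` for basis vectors outside `L` is harmless, since the corresponding coordinates
vanish on `L`. -/
theorem IsCoordinate.sum_smul_basisVec {L : Submodule ℤ (Fin d → ℤ)} (hL : IsCoordinate L)
    (m : L) : ∑ i, m.1 i • basisVec L i = m := by
  have h : ∀ i, ((m.1 i • basisVec L i : L) : Fin d → ℤ) = Pi.single i (m.1 i) := by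
    intro i
    by_cases hi : m.1 i = 0
    · simp [hi]
    · rw [basisVec, dif_pos (hL m.1 m.2 i hi)]
      ext j
      simp [Pi.single_apply]
  apply Subtype.ext
  rw [AddSubmonoidClass.coe_finsetSum]
  simp only [h]
  exact Finset.univ_sum_single m.1

/-- The reduction modulo `2` of the coordinates of a vector. -/
def coord (L : Submodule ℤ (Fin d → ℤ)) :
    ZMod 2 ⊗[ℤ] ⋀[ℤ]^1 L →ₗ[ZMod 2] (Fin d → ZMod 2) :=
  LinearMap.liftBaseChange (ZMod 2)
    ((LinearMap.pi fun i => Algebra.linearMap ℤ (ZMod 2) ∘ₗ LinearMap.proj i) ∘ₗ L.subtype ∘ₗ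
      (exteriorPower.oneEquiv ℤ L).toLinearMap)

theorem coord_tmul (L : Submodule ℤ (Fin d → ℤ)) (s : ZMod 2) (m : L) (i : Fin d) :
    coord L (s ⊗ₜ (exteriorPower.oneEquiv ℤ L).symm m) i = s * (m.1 i : ZMod 2) := by
  simp [coord]

/-- The class modulo `2` of `basisVec L i` in the first exterior power. -/
def basisClass (L : Submodule ℤ (Fin d → ℤ)) (i : Fin d) : ZMod 2 ⊗[ℤ] ⋀[ℤ]^1 L :=
  1 ⊗ₜ (exteriorPower.oneEquiv ℤ L).symm (basisVec L i)

theorem induction_exteriorPower_one {L : Submodule ℤ (Fin d → ℤ)}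
    {motive : ZMod 2 ⊗[ℤ] ⋀[ℤ]^1 L → Prop}
    (tmul : ∀ s m, motive (s ⊗ₜ (exteriorPower.oneEquiv ℤ L).symm m))
    (add : ∀ a b, motive a → motive b → motive (a + b)) (a : ZMod 2 ⊗[ℤ] ⋀[ℤ]^1 L) :
    motive a := by
  induction a using TensorProduct.induction_on with
  | zero => simpa using tmul 0 0
  | add a b ha hb => exact add a b ha hb
  | tmul s a => simpa using tmul s (exteriorPower.oneEquiv ℤ L a)

theorem IsCoordinate.sum_coord_smul {L : Submodule ℤ (Fin d → ℤ)} (hL : IsCoordinate L)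
    (a : ZMod 2 ⊗[ℤ] ⋀[ℤ]^1 L) : ∑ i, coord L a i • basisClass L i = a := by
  induction a using induction_exteriorPower_one with
  | add a b ha hb =>
    simp only [map_add, Pi.add_apply, add_smul, Finset.sum_add_distrib, ha, hb]
  | tmul s m =>
    have h : ∀ i, coord L (s ⊗ₜ (exteriorPower.oneEquiv ℤ L).symm m) i • basisClass L i =
        s ⊗ₜ[ℤ] (exteriorPower.oneEquiv ℤ L).symm (m.1 i • basisVec L i) := by
      intro i
      rw [coord_tmul, basisClass, map_smul, TensorProduct.tmul_smul, TensorProduct.smul_tmul',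
        TensorProduct.smul_tmul']
      congr 1
      simp [mul_comm]
    simp only [h, ← TensorProduct.tmul_sum, ← map_sum, hL.sum_smul_basisVec]

theorem IsCoordinate.coord_injective {L : Submodule ℤ (Fin d → ℤ)} (hL : IsCoordinate L) :
    Function.Injective (coord L) := fun a b h => by
  rw [← hL.sum_coord_smul a, ← hL.sum_coord_smul b, h]

theorem coord_eq_zero {L : Submodule ℤ (Fin d → ℤ)} {i : Fin d} (hi : ∀ m ∈ L, m i = 0)
    (a : ZMod 2 ⊗[ℤ] ⋀[ℤ]^1 L) : coord L a i = 0 := by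
  induction a using induction_exteriorPower_one with
  | add a b ha hb => simp [ha, hb]
  | tmul s m => simp [coord_tmul, hi m.1 m.2]

/-- The element of the first exterior power with the given coordinates (those outside `L` are
discarded). -/
def ofCoord (L : Submodule ℤ (Fin d → ℤ)) (t : Fin d → ZMod 2) : ZMod 2 ⊗[ℤ] ⋀[ℤ]^1 L :=
  ∑ i, t i • basisClass L i

theorem coord_basisClass {L : Submodule ℤ (Fin d → ℤ)} {i : Fin d} (hi : Pi.single i 1 ∈ L) :
    coord L (basisClass L i) = Pi.single i 1 := by
  ext j
  rw [basisClass, coord_tmul, basisVec, dif_pos hi]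
  by_cases h : j = i
  · subst h; simp
  · simp [h]

theorem coord_ofCoord {L : Submodule ℤ (Fin d → ℤ)} {t : Fin d → ZMod 2}
    (ht : ∀ i, t i ≠ 0 → Pi.single i 1 ∈ L) : coord L (ofCoord L t) = t := by
  have h : ∀ i, t i • coord L (basisClass L i) = Pi.single i (t i) := by
    intro i
    by_cases hi : t i = 0
    · simp [hi]
    · rw [coord_basisClass (ht i hi)]
      ext j
      simp [Pi.single_apply]
  simp only [ofCoord, map_sum, map_smul, h]
  exact Finset.univ_sum_single t

theorem inclusionMap_one_tmul {L L' : Submodule ℤ (Fin d → ℤ)} (h : L ≤ L') (s : ZMod 2)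
    (m : L) : inclusionMap 1 h (s ⊗ₜ (exteriorPower.oneEquiv ℤ L).symm m) =
      s ⊗ₜ (exteriorPower.oneEquiv ℤ L').symm (Submodule.inclusion h m) := by
  rw [inclusionMap, LinearMap.baseChange_tmul]
  congr 1
  have e := LinearMap.congr_fun (exteriorPower.oneEquiv_naturality (Submodule.inclusion h))
    ((exteriorPower.oneEquiv ℤ L).symm m)
  rw [LinearEquiv.eq_symm_apply]
  simpa using e

theorem coord_inclusionMap {L L' : Submodule ℤ (Fin d → ℤ)} (h : L ≤ L')
    (a : ZMod 2 ⊗[ℤ] ⋀[ℤ]^1 L) : coord L' (inclusionMap 1 h a) = coord L a := by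
  induction a using induction_exteriorPower_one with
  | add a b ha hb => simp [ha, hb]
  | tmul s m =>
    ext i
    simp [inclusionMap_one_tmul, coord_tmul]

theorem inclusionMap_basisClass {L L' : Submodule ℤ (Fin d → ℤ)} (h : L ≤ L') {i : Fin d}
    (hi : Pi.single i 1 ∈ L) : inclusionMap 1 h (basisClass L i) = basisClass L' i := by
  rw [basisClass, inclusionMap_one_tmul, basisClass, basisVec, basisVec, dif_pos hi,
    dif_pos (h hi)]
  rfl

/-- The coefficient modulo `2` of `e_i ∧ e_j`. -/
def coordTwo (L : Submodule ℤ (Fin d → ℤ)) (i j : Fin d) :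
    ZMod 2 ⊗[ℤ] ⋀[ℤ]^(1 + 1) L →ₗ[ZMod 2] ZMod 2 :=
  LinearMap.liftBaseChange (ZMod 2)
    (Algebra.linearMap ℤ (ZMod 2) ∘ₗ exteriorPower.alternatingMapLinearEquiv
      ((Matrix.detRowAlternating (n := Fin (1 + 1)) (R := ℤ)).compLinearMap
        ((LinearMap.pi fun k => LinearMap.proj (![i, j] k)) ∘ₗ L.subtype)))

theorem wedge_oneEquiv_symm (L : Submodule ℤ (Fin d → ℤ)) (m m' : L) :
    wedge L 1 1 ((exteriorPower.oneEquiv ℤ L).symm m) ((exteriorPower.oneEquiv ℤ L).symm m') =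
      exteriorPower.ιMulti ℤ (1 + 1) ![m, m'] := by
  have h : ∀ m : L, (exteriorPower.oneEquiv ℤ L).symm m =
      exteriorPower.ιMulti ℤ 1 (fun _ => m) := fun m => by
    rw [LinearEquiv.symm_apply_eq]; simp
  rw [h, h]
  apply Subtype.ext
  simp [wedge, ExteriorAlgebra.ιMulti_apply]

theorem coordTwo_wedge (L : Submodule ℤ (Fin d → ℤ)) (i j : Fin d)
    (a b : ZMod 2 ⊗[ℤ] ⋀[ℤ]^1 L) :
    coordTwo L i j (wedgeModTwo L 1 1 a b) =
      coord L a i * coord L b j - coord L a j * coord L b i := by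
  induction a using induction_exteriorPower_one with
  | add a a' ha ha' =>
    simp only [map_add, LinearMap.add_apply, ha, ha', Pi.add_apply]; ring
  | tmul s m =>
    induction b using induction_exteriorPower_one with
    | add b b' hb hb' => simp only [map_add, hb, hb', Pi.add_apply]; ring
    | tmul t m' =>
      rw [wedgeModTwo_tmul, wedge_oneEquiv_symm]
      simp only [coord_tmul, coordTwo, LinearMap.liftBaseChange_tmul, LinearMap.comp_apply,
        exteriorPower.alternatingMapLinearEquiv_apply_ιMulti]
      rw [AlternatingMap.compLinearMap_apply]
      have hdet : ∀ f : Fin (1 + 1) → Fin (1 + 1) → ℤ, Matrix.detRowAlternating f =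
          f 0 0 * f 1 1 - f 0 1 * f 1 0 := fun f => Matrix.det_fin_two (Matrix.of f)
      rw [hdet]
      simp
      ring

/-- Products of two degree-one classes span, so linear maps need only be compared on them. This
reduces statements about `coordTwo` to 2×2 minors. -/
theorem exteriorPower_two_hom_ext {L : Submodule ℤ (Fin d → ℤ)} {M : Type*} [AddCommGroup M]
    [Module (ZMod 2) M] {f g : ZMod 2 ⊗[ℤ] ⋀[ℤ]^(1 + 1) L →ₗ[ZMod 2] M}
    (h : ∀ a b, f (wedgeModTwo L 1 1 a b) = g (wedgeModTwo L 1 1 a b)) : f = g := by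
  have key : (f.toAddMonoidHom.toIntLinearMap ∘ₗ TensorProduct.mk ℤ (ZMod 2) (⋀[ℤ]^(1 + 1) L) 1) =
      g.toAddMonoidHom.toIntLinearMap ∘ₗ TensorProduct.mk ℤ (ZMod 2) (⋀[ℤ]^(1 + 1) L) 1 := by
    apply exteriorPower.linearMap_ext
    ext m
    have e := h (1 ⊗ₜ (exteriorPower.oneEquiv ℤ L).symm (m 0))
      (1 ⊗ₜ (exteriorPower.oneEquiv ℤ L).symm (m 1))
    rw [wedgeModTwo_tmul, wedge_oneEquiv_symm, mul_one] at e
    have hm : m = ![m 0, m 1] := by ext i; fin_cases i <;> rfl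
    rw [hm]
    exact e
  apply LinearMap.ext
  intro w
  induction w using TensorProduct.induction_on with
  | zero => simp
  | add a b ha hb => simp [ha, hb]
  | tmul s x =>
    have hs : s ⊗ₜ[ℤ] x = s • ((1 : ZMod 2) ⊗ₜ[ℤ] x) := by simp [TensorProduct.smul_tmul']
    rw [hs, map_smul, map_smul]
    exact congrArg _ (LinearMap.congr_fun key x)

theorem coordTwo_inclusionMap {L L' : Submodule ℤ (Fin d → ℤ)} (h : L ≤ L') (i j : Fin d)
    (w : ZMod 2 ⊗[ℤ] ⋀[ℤ]^(1 + 1) L) : coordTwo L' i j (inclusionMap (1 + 1) h w) = coordTwo L i j w := by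
  suffices H : coordTwo L' i j ∘ₗ inclusionMap (1 + 1) h = coordTwo L i j from
    LinearMap.congr_fun H w
  refine exteriorPower_two_hom_ext fun a b => ?_
  rw [LinearMap.comp_apply, wedgeModTwo_inclusionMap]
  simp only [coordTwo_wedge, coord_inclusionMap]

theorem coordTwo_eq_zero {L : Submodule ℤ (Fin d → ℤ)} {i j : Fin d}
    (h : (∀ m ∈ L, m i = 0) ∨ ∀ m ∈ L, m j = 0) (w : ZMod 2 ⊗[ℤ] ⋀[ℤ]^(1 + 1) L) :
    coordTwo L i j w = 0 := by
  suffices H : coordTwo L i j = 0 from LinearMap.congr_fun H w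
  refine exteriorPower_two_hom_ext fun a b => ?_
  rw [coordTwo_wedge]
  rcases h with h | h <;> simp [coord_eq_zero h]

theorem wedge_tmul_self (L : Submodule ℤ (Fin d → ℤ)) (s t : ZMod 2) (m : L) :
    wedgeModTwo L 1 1 (s ⊗ₜ (exteriorPower.oneEquiv ℤ L).symm m)
      (t ⊗ₜ (exteriorPower.oneEquiv ℤ L).symm m) = 0 := by
  rw [wedgeModTwo_tmul, wedge_oneEquiv_symm,
    (exteriorPower.ιMulti ℤ (1 + 1)).map_eq_zero_of_eq _ (i := 0) (j := 1) rfl (by decide)]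
  exact TensorProduct.tmul_zero _ _

theorem wedge_basisClass_self (L : Submodule ℤ (Fin d → ℤ)) (i : Fin d) :
    wedgeModTwo L 1 1 (basisClass L i) (basisClass L i) = 0 :=
  wedge_tmul_self L 1 1 _

theorem neg_eq_self_of_zmod_two {M : Type*} [AddCommGroup M] [Module (ZMod 2) M] (x : M) :
    -x = x := by
  rw [← neg_one_smul (ZMod 2) x, ← one_smul (ZMod 2) x, smul_smul]
  rfl

/-- Expand the square of `e_i + e_j`, which is zero; the sign is invisible modulo 2. -/
theorem wedge_basisClass_comm (L : Submodule ℤ (Fin d → ℤ)) (i j : Fin d) :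
    wedgeModTwo L 1 1 (basisClass L i) (basisClass L j) =
      wedgeModTwo L 1 1 (basisClass L j) (basisClass L i) := by
  have h := wedge_tmul_self L 1 1 (basisVec L i + basisVec L j)
  simp only [map_add, TensorProduct.tmul_add, LinearMap.add_apply] at h
  change wedgeModTwo L 1 1 (basisClass L i) (basisClass L i) +
    wedgeModTwo L 1 1 (basisClass L j) (basisClass L i) +
    (wedgeModTwo L 1 1 (basisClass L i) (basisClass L j) +
    wedgeModTwo L 1 1 (basisClass L j) (basisClass L j)) = 0 at h
  rw [wedge_basisClass_self, wedge_basisClass_self, zero_add, add_zero] at h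
  rw [eq_neg_of_add_eq_zero_left h, neg_eq_self_of_zmod_two]

/-- The sum `∑_{i<j} cᵢ cⱼ wᵢⱼ`. -/
def quadSum {M : Type*} [AddCommGroup M] [Module (ZMod 2) M] (c : Fin d → ZMod 2)
    (w : Fin d → Fin d → M) : M :=
  ∑ i, ∑ j, if i < j then (c i * c j) • w i j else 0

theorem map_quadSum {M N : Type*} [AddCommGroup M] [Module (ZMod 2) M] [AddCommGroup N]
    [Module (ZMod 2) N] (f : M →ₗ[ZMod 2] N) (c : Fin d → ZMod 2) (w : Fin d → Fin d → M) :
    f (quadSum c w) = quadSum c fun i j => f (w i j) := by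
  simp only [quadSum, map_sum]
  refine Finset.sum_congr rfl fun i _ => Finset.sum_congr rfl fun j _ => ?_
  split_ifs <;> simp

theorem quadSum_congr {M : Type*} [AddCommGroup M] [Module (ZMod 2) M] {c : Fin d → ZMod 2}
    {w w' : Fin d → Fin d → M} (h : ∀ i j, c i ≠ 0 → c j ≠ 0 → w i j = w' i j) :
    quadSum c w = quadSum c w' := by
  refine Finset.sum_congr rfl fun i _ => Finset.sum_congr rfl fun j _ => ?_
  by_cases hi : c i = 0
  · simp [hi]
  by_cases hj : c j = 0
  · simp [hj]
  rw [h i j hi hj]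

theorem sum_sum_eq_sum_lt {M : Type*} [AddCommGroup M]
    {f : Fin d → Fin d → M} (hf : ∀ i, f i i = 0) :
    ∑ i, ∑ j, f i j = ∑ i, ∑ j, if i < j then f i j + f j i else 0 := by
  have h1 : ∀ i j, f i j = (if i < j then f i j else 0) + (if j < i then f i j else 0) := by
    intro i j
    rcases lt_trichotomy i j with h | h | h
    · simp [h, h.not_gt]
    · subst h; simp [hf]
    · simp [h, h.not_gt]
  have h2 : ∑ i, ∑ j, (if j < i then f i j else 0) = ∑ i, ∑ j, if i < j then f j i else 0 :=
    Finset.sum_comm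
  rw [Finset.sum_congr rfl fun i _ => Finset.sum_congr rfl fun j _ => h1 i j]
  simp only [Finset.sum_add_distrib, h2]
  simp only [← Finset.sum_add_distrib]
  refine Finset.sum_congr rfl fun i _ => Finset.sum_congr rfl fun j _ => ?_
  split_ifs <;> simp

/-- Polarisation: by the symmetry of `w` the cross terms `cᵢ c'ⱼ` and `cⱼ c'ᵢ` with `i < j` fill up
the full double sum, whose diagonal vanishes. -/
theorem quadSum_add {M : Type*} [AddCommGroup M] [Module (ZMod 2) M] (c c' : Fin d → ZMod 2)
    {w : Fin d → Fin d → M} (hw : ∀ i, w i i = 0) (hw' : ∀ i j, w i j = w j i) :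
    quadSum (c + c') w = quadSum c w + quadSum c' w + ∑ i, ∑ j, (c i * c' j) • w i j := by
  rw [sum_sum_eq_sum_lt (fun i => by rw [hw, smul_zero])]
  simp only [quadSum, ← Finset.sum_add_distrib]
  refine Finset.sum_congr rfl fun i _ => Finset.sum_congr rfl fun j _ => ?_
  split_ifs
  · rw [hw' j i, Pi.add_apply, Pi.add_apply]
    module
  · simp

theorem map_sum_smul_sum_smul {M N : Type*} [AddCommGroup M] [Module (ZMod 2) M]
    [AddCommGroup N] [Module (ZMod 2) N] (B : M →ₗ[ZMod 2] M →ₗ[ZMod 2] N)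
    (c c' : Fin d → ZMod 2) (e : Fin d → M) :
    B (∑ i, c i • e i) (∑ j, c' j • e j) = ∑ i, ∑ j, (c i * c' j) • B (e i) (e j) := by
  simp only [map_sum, LinearMap.sum_apply, map_smul, LinearMap.smul_apply, Finset.smul_sum,
    smul_smul]
  rw [Finset.sum_comm]
  simp only [mul_comm]

/-- The quadratic refinement `∑ aᵢ eᵢ ↦ ∑_{i<j} aᵢ aⱼ eᵢ ∧ eⱼ` of the exterior product. -/
def quadRefinement (L : Submodule ℤ (Fin d → ℤ)) (a : ZMod 2 ⊗[ℤ] ⋀[ℤ]^1 L) :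
    ZMod 2 ⊗[ℤ] ⋀[ℤ]^(1 + 1) L :=
  quadSum (coord L a) fun i j => wedgeModTwo L 1 1 (basisClass L i) (basisClass L j)

theorem IsCoordinate.single_mem_of_coord_ne_zero {L : Submodule ℤ (Fin d → ℤ)}
    (hL : IsCoordinate L) {a : ZMod 2 ⊗[ℤ] ⋀[ℤ]^1 L} {i : Fin d} (hi : coord L a i ≠ 0) :
    Pi.single i 1 ∈ L := by
  by_contra hn
  exact hi (coord_eq_zero (fun m hm => by_contra fun h0 => hn (hL m hm i h0)) a)

/-- Only indices with nonzero coordinates contribute, and for those `e_i` lies in `L`, hence is the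
same basis vector in `L'`. This fails for lattices without a common adapted basis. -/
theorem quadRefinement_inclusionMap {L L' : Submodule ℤ (Fin d → ℤ)} (hL : IsCoordinate L)
    (h : L ≤ L') (a : ZMod 2 ⊗[ℤ] ⋀[ℤ]^1 L) :
    quadRefinement L' (inclusionMap 1 h a) = inclusionMap (1 + 1) h (quadRefinement L a) := by
  rw [quadRefinement, quadRefinement, map_quadSum, coord_inclusionMap]
  refine quadSum_congr fun i j hi hj => ?_
  rw [wedgeModTwo_inclusionMap, inclusionMap_basisClass h (hL.single_mem_of_coord_ne_zero hi),
    inclusionMap_basisClass h (hL.single_mem_of_coord_ne_zero hj)]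

theorem quadRefinement_add {L : Submodule ℤ (Fin d → ℤ)} (hL : IsCoordinate L)
    (a b : ZMod 2 ⊗[ℤ] ⋀[ℤ]^1 L) :
    quadRefinement L (a + b) =
      quadRefinement L a + quadRefinement L b + wedgeModTwo L 1 1 a b := by
  have hw := map_sum_smul_sum_smul (wedgeModTwo L 1 1) (coord L a) (coord L b) (basisClass L)
  rw [hL.sum_coord_smul, hL.sum_coord_smul] at hw
  rw [hw]
  exact (congrArg (quadSum · _) ((coord L).map_add a b)).trans
    (quadSum_add _ _ (wedge_basisClass_self L) (wedge_basisClass_comm L))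

end Coordinates

/-! ### The cones of the normal fan of the cube -/

section CubeFan

variable {d : ℕ}

theorem mem_cube {u : Fin d → ℝ} : u ∈ cube d ↔ ∀ i, -1 ≤ u i ∧ u i ≤ 1 := by
  simp [cube, Set.mem_Icc, Pi.le_def, forall_and]

/-- A maximiser over the cube of a linear form maximises each of its terms. -/
theorem mul_le_mul_of_dotProduct_le {u v : Fin d → ℝ} (hu : u ∈ cube d)
    (h : ∀ w ∈ cube d, w ⬝ᵥ v ≤ u ⬝ᵥ v) (i : Fin d) {t : ℝ} (ht : -1 ≤ t) (ht' : t ≤ 1) :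
    t * v i ≤ u i * v i := by
  -- The competitor is `u` with its `i`-th coordinate replaced by `t`.
  have hw : u + Pi.single i (t - u i) ∈ cube d := by
    rw [mem_cube] at hu ⊢
    intro j
    by_cases hj : j = i
    · subst hj; simp [ht, ht']
    · simp [hj, hu j]
  have := h _ hw
  rw [add_dotProduct, single_dotProduct] at this
  linarith

/-- The cube is a product of intervals, so a linear form is maximised coordinate by coordinate and
each term of `v` is itself normal along `A`. -/
theorem single_mem_normalCone_of_mem {A : Set (Fin d → ℝ)} (hA : A ⊆ cube d) {v : Fin d → ℝ}
    (hv : v ∈ normalCone (cube d) A) (i : Fin d) : Pi.single i (v i) ∈ normalCone (cube d) A := by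
  intro u hu w hw
  rw [dotProduct_single, dotProduct_single]
  have := mem_cube.1 hw i
  exact mul_le_mul_of_dotProduct_le (hA hu) (hv u hu) i this.1 this.2

theorem subset_cube_of_mem_cubeFan {ρ : PointedCone ℝ (Fin d → ℝ)} (hρ : ρ ∈ cubeFan d) :
    ∃ A : Set (Fin d → ℝ), A.Nonempty ∧ A ⊆ cube d ∧ ρ = normalCone (cube d) A := by
  obtain ⟨A, hA, hexp, rfl⟩ := hρ
  exact ⟨A, hA, hexp.subset, rfl⟩

theorem single_mem_of_mem_cubeFan {ρ : PointedCone ℝ (Fin d → ℝ)} (hρ : ρ ∈ cubeFan d)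
    {v : Fin d → ℝ} (hv : v ∈ ρ) (i : Fin d) : Pi.single i (v i) ∈ ρ := by
  obtain ⟨A, -, hA, rfl⟩ := subset_cube_of_mem_cubeFan hρ
  exact single_mem_normalCone_of_mem hA hv i

theorem single_mul_mem {ρ : PointedCone ℝ (Fin d → ℝ)} {i : Fin d} {t r : ℝ}
    (h : Pi.single i t ∈ ρ) (hr : 0 ≤ r) : Pi.single i (r * t) ∈ ρ := by
  have := ρ.smul_mem hr h
  rwa [← Pi.single_smul, smul_eq_mul] at this

/-- A vector of a cone of the fan with a nonzero coordinate shows that one of the corresponding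
two opposite rays lies in the cone. -/
theorem exists_single_mem {ρ : PointedCone ℝ (Fin d → ℝ)} (hρ : ρ ∈ cubeFan d)
    {v : Fin d → ℝ} (hv : v ∈ ρ) {i : Fin d} (hi : v i ≠ 0) :
    Pi.single i 1 ∈ ρ ∨ Pi.single i (-1) ∈ ρ := by
  have h := single_mem_of_mem_cubeFan hρ hv i
  rcases lt_or_gt_of_ne hi with h0 | h0
  · right
    have := single_mul_mem h (r := -(v i)⁻¹) (by simpa using h0.le)
    rwa [neg_mul, inv_mul_cancel₀ hi] at this
  · left
    have := single_mul_mem h (r := (v i)⁻¹) (by simpa using h0.le)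
    rwa [inv_mul_cancel₀ hi] at this

/-- Otherwise a point of the nonempty face would have `i`-th coordinate both at least `1` and at
most `-1`. -/
theorem not_single_neg_mem {ρ : PointedCone ℝ (Fin d → ℝ)} (hρ : ρ ∈ cubeFan d) {i : Fin d}
    (h : Pi.single i 1 ∈ ρ) : Pi.single i (-1) ∉ ρ := by
  obtain ⟨A, ⟨u, hu⟩, hA, rfl⟩ := subset_cube_of_mem_cubeFan hρ
  intro h'
  have e := mul_le_mul_of_dotProduct_le (hA hu) (h u hu) i (t := 1) (by norm_num) le_rfl
  have e' := mul_le_mul_of_dotProduct_le (hA hu) (h' u hu) i (t := -1) le_rfl (by norm_num)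
  simp at e e'
  linarith

/-- A coordinate that is nonzero somewhere on the cone forces `e_i` or `-e_i` into it, so
orthogonality is tested on these rays. -/
theorem mem_perp_iff {ρ : PointedCone ℝ (Fin d → ℝ)} (hρ : ρ ∈ cubeFan d) {m : Fin d → ℤ} :
    m ∈ perp ρ ↔ ∀ i, Pi.single i 1 ∈ ρ ∨ Pi.single i (-1) ∈ ρ → m i = 0 := by
  constructor
  · rintro hm i (h | h)
    · simpa using hm _ h
    · simpa using hm _ h
  · intro h v hv
    refine Finset.sum_eq_zero fun i _ => ?_
    by_cases hi : v i = 0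
    · simp [hi]
    · simp [h i (exists_single_mem hρ hv hi)]

theorem single_mem_perp_iff {ρ : PointedCone ℝ (Fin d → ℝ)} (hρ : ρ ∈ cubeFan d) {i : Fin d} :
    Pi.single i 1 ∈ perp ρ ↔ Pi.single i 1 ∉ ρ ∧ Pi.single i (-1) ∉ ρ := by
  rw [mem_perp_iff hρ, ← not_or]
  constructor
  · intro h h'
    simpa using h i h'
  · intro h j hj
    rw [Pi.single_apply, if_neg]
    rintro rfl
    exact h hj

theorem isCoordinate_perp {ρ : PointedCone ℝ (Fin d → ℝ)} (hρ : ρ ∈ cubeFan d) :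
    IsCoordinate (perp ρ) := by
  intro m hm i hi
  rw [single_mem_perp_iff hρ, ← not_or]
  exact fun h => hi ((mem_perp_iff hρ).1 hm i h)

/-- The face of the cube on which the linear form `v` is maximal. -/
def maximalFace (v : Fin d → ℝ) : Set (Fin d → ℝ) :=
  {u ∈ cube d | ∀ w ∈ cube d, w ⬝ᵥ v ≤ u ⬝ᵥ v}

theorem maximalFace_nonempty (v : Fin d → ℝ) : (maximalFace v).Nonempty := by
  have hc : IsCompact (cube d) := isCompact_Icc
  have hn : (cube d).Nonempty := ⟨0, mem_cube.2 fun i => by simp⟩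
  obtain ⟨u, hu, h⟩ := hc.exists_isMaxOn hn (f := fun w => w ⬝ᵥ v)
    (Continuous.continuousOn (by unfold dotProduct; fun_prop))
  exact ⟨u, hu, h⟩

theorem normalCone_maximalFace_mem (v : Fin d → ℝ) :
    normalCone (cube d) (maximalFace v) ∈ cubeFan d := by
  refine ⟨_, maximalFace_nonempty v, fun _ => ?_, rfl⟩
  let l : (Fin d → ℝ) →ₗ[ℝ] ℝ := (dotProductBilin ℝ ℝ).flip v
  exact ⟨LinearMap.toContinuousLinearMap l, rfl⟩

/-- The smallest cone of the fan containing `v`: the vectors `w` whose coordinates are zero or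
have the sign of the corresponding coordinate of `v`. -/
theorem mem_normalCone_maximalFace {v w : Fin d → ℝ} :
    w ∈ normalCone (cube d) (maximalFace v) ↔ ∀ i, (v i = 0 → w i = 0) ∧ 0 ≤ v i * w i := by
  constructor
  · intro hw i
    -- Any value `t` maximising the `i`-th term of `v` is the `i`-th coordinate of a point of the
    -- face, so it also maximises the `i`-th term of `w`.
    have key : ∀ t : ℝ, -1 ≤ t → t ≤ 1 → (∀ r : ℝ, -1 ≤ r → r ≤ 1 → r * v i ≤ t * v i) →
        ∀ r : ℝ, -1 ≤ r → r ≤ 1 → r * w i ≤ t * w i := by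
      intro t ht ht' hmax r hr hr'
      obtain ⟨u, hu, hm⟩ := maximalFace_nonempty v
      have hu' : u + Pi.single i (t - u i) ∈ maximalFace v := by
        constructor
        · rw [mem_cube] at hu ⊢
          intro j
          by_cases hj : j = i
          · subst hj; simp [ht, ht']
          · simp [hj, hu j]
        · intro y hy
          rw [add_dotProduct, single_dotProduct]
          have := hm y hy
          have := hmax (u i) (mem_cube.1 hu i).1 (mem_cube.1 hu i).2
          linarith
      have := mul_le_mul_of_dotProduct_le hu'.1 (hw _ hu') i hr hr'
      simpa using this
    constructor
    · intro h0
      have h1 := key 1 (by norm_num) le_rfl (by simp [h0]) (-1) le_rfl (by norm_num)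
      have h2 := key (-1) le_rfl (by norm_num) (by simp [h0]) 1 (by norm_num) le_rfl
      linarith
    · rcases le_total 0 (v i) with h0 | h0
      · have h1 := key 1 (by norm_num) le_rfl
          (fun r _ hr => mul_le_mul_of_nonneg_right hr h0) 0 (by norm_num) (by norm_num)
        exact mul_nonneg h0 (by linarith)
      · have h1 := key (-1) le_rfl (by norm_num)
          (fun r hr _ => mul_le_mul_of_nonpos_right hr h0) 0 (by norm_num) (by norm_num)
        exact mul_nonneg_of_nonpos_of_nonpos h0 (by linarith)
  · intro h u hu y hy
    refine Finset.sum_le_sum fun i _ => ?_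
    have hy' := mem_cube.1 hy i
    have hmax : ∀ t : ℝ, -1 ≤ t → t ≤ 1 → t * v i ≤ u i * v i := fun t ht ht' =>
      mul_le_mul_of_dotProduct_le hu.1 hu.2 i ht ht'
    rcases lt_trichotomy (v i) 0 with h0 | h0 | h0
    · have h1 : u i ≤ -1 := (mul_le_mul_right_of_neg h0).1 (hmax (-1) le_rfl (by norm_num))
      have h2 : w i ≤ 0 := nonpos_of_mul_nonneg_right (h i).2 h0
      exact mul_le_mul_of_nonpos_right (h1.trans hy'.1) h2
    · simp [(h i).1 h0]
    · have h1 : 1 ≤ u i := le_of_mul_le_mul_right (hmax 1 (by norm_num) le_rfl) h0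
      have h2 : 0 ≤ w i := nonneg_of_mul_nonneg_right (h i).2 h0
      exact mul_le_mul_of_nonneg_right (hy'.2.trans h1) h2

/-- The cell of the smallest cone containing `v`. -/
def cell (v : Fin d → ℝ) : CellPoset (cubeFan d) :=
  OrderDual.toDual ⟨_, normalCone_maximalFace_mem v⟩

theorem mem_cone_cell {v w : Fin d → ℝ} :
    w ∈ (cell v).cone ↔ ∀ i, (v i = 0 → w i = 0) ∧ 0 ≤ v i * w i :=
  mem_normalCone_maximalFace

theorem self_mem_cone_cell (v : Fin d → ℝ) : v ∈ (cell v).cone :=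
  mem_cone_cell.2 fun _ => ⟨id, mul_self_nonneg _⟩

theorem CellPoset.cone_mem (x : CellPoset (cubeFan d)) : x.cone ∈ cubeFan d :=
  (OrderDual.ofDual x).2

/-- The order reverses inclusion, and the cone of `cell v` is the smallest one containing `v`: its
vectors are sums of nonnegative multiples of the coordinate components of `v`. -/
theorem le_cell_iff {x : CellPoset (cubeFan d)} {v : Fin d → ℝ} :
    x ≤ cell v ↔ v ∈ x.cone := by
  constructor
  · intro h
    exact (show (cell v).cone ≤ x.cone from h) (self_mem_cone_cell v)
  · intro h w hw
    have hw' := mem_cone_cell.1 hw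
    rw [← Finset.univ_sum_single w]
    refine Submodule.sum_mem _ fun i _ => ?_
    have hi := single_mem_of_mem_cubeFan x.cone_mem h i
    by_cases h0 : v i = 0
    · rw [(hw' i).1 h0, Pi.single_zero]; exact x.cone.zero_mem
    · have := single_mul_mem hi (r := w i / v i) (by
        rw [← mul_div_mul_left _ _ h0]
        exact div_nonneg (hw' i).2 (mul_self_nonneg _))
      rwa [div_mul_cancel₀ _ h0] at this

/-- The zero cone gives the open cell, the top of the poset; this is the source of the potentials
`topValue`. -/
theorem le_cell_zero (x : CellPoset (cubeFan d)) : x ≤ cell 0 :=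
  le_cell_iff.2 x.cone.zero_mem

end CubeFan

/-! ### Cochains on short chains -/

section ShortChains

variable {P : Type*} [PartialOrder P] {x y z : P}

/-- The chain consisting of `x`. -/
def pointChain (x : P) : Chain P 0 :=
  OrderEmbedding.ofStrictMono (fun _ => x) fun i j h => by
    have := i.2; have := j.2; have := Fin.lt_def.1 h; omega

/-- The chain `x < y`. -/
def pairChain (h : x < y) : Chain P 1 :=
  OrderEmbedding.ofStrictMono ![x, y] (Fin.strictMono_iff_lt_succ.2 fun i => by
    fin_cases i; exact h)

/-- The chain `x < y < z`. -/
def tripleChain (h : x < y) (h' : y < z) : Chain P 2 :=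
  OrderEmbedding.ofStrictMono ![x, y, z] (Fin.strictMono_iff_lt_succ.2 fun i => by
    fin_cases i
    · exact h
    · exact h')

theorem pairChain_face_zero (h : x < y) : (pairChain h).face 0 = pointChain y := by
  ext i; fin_cases i; rfl

theorem tripleChain_face_zero (h : x < y) (h' : y < z) :
    (tripleChain h h').face 0 = pairChain h' := by
  ext i; fin_cases i <;> rfl

theorem tripleChain_face_one (h : x < y) (h' : y < z) :
    (tripleChain h h').face 1 = pairChain (h.trans h') := by
  ext i; fin_cases i <;> rfl

theorem tripleChain_face_two (h : x < y) (h' : y < z) :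
    (tripleChain h h').face 2 = pairChain h := by
  ext i; fin_cases i <;> rfl

theorem tripleChain_front (h : x < y) (h' : y < z) :
    Chain.front (p := 1) (q := 1) (tripleChain h h') = pairChain h := by
  ext i; fin_cases i <;> rfl

theorem tripleChain_back (h : x < y) (h' : y < z) :
    Chain.back (p := 1) (q := 1) (tripleChain h h') = pairChain h' := by
  ext i; fin_cases i <;> rfl

theorem eq_pairChain (c : Chain P 1) : c = pairChain (c.strictMono Fin.zero_lt_one) := by
  ext i; fin_cases i <;> rfl

end ShortChains

/-! ### Comparing sections over different cells in a fixed module -/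

section Cocone

variable {k : Type*} [CommRing k] {P : Type*} [PartialOrder P]

/-- A compatible family of linear maps from the stalks of a sheaf to a fixed module. -/
structure SheafCocone (F : PosetSheaf k P) (M : Type*) [AddCommGroup M] [Module k M] where
  app : ∀ x, F.obj x →ₗ[k] M
  app_map : ∀ {x y} (h : x ≤ y) (a : F.obj x), app y (F.map h a) = app x a

variable {F : PosetSheaf k P} {M : Type*} [AddCommGroup M] [Module k M]

/-- The image of a cochain under a cocone. -/
def SheafCocone.value (l : SheafCocone F M) {q : ℕ} (c : Chain P q) : Cochain F q →ₗ[k] M :=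
  l.app (c (Fin.last q)) ∘ₗ LinearMap.proj c

theorem SheafCocone.value_apply (l : SheafCocone F M) {q : ℕ} (c : Chain P q)
    (a : Cochain F q) : l.value c a = l.app (c (Fin.last q)) (a c) := rfl

theorem SheafCocone.value_coboundary_zero (l : SheafCocone F M) (s : Cochain F 0)
    (c : Chain P 1) :
    l.value c (coboundary F 0 s) = l.value (c.face 0) s - l.value (c.face 1) s := by
  simp only [value_apply, coboundary_zero_apply, map_sub, l.app_map]

theorem SheafCocone.value_coboundary_one (l : SheafCocone F M) (a : Cochain F 1)
    (c : Chain P 2) :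
    l.value (q := 1 + 1) c (coboundary F 1 a) =
      l.value (c.face 0) a - l.value (c.face 1) a + l.value (c.face 2) a := by
  rw [value_apply, coboundary_apply, Fin.sum_univ_three]
  simp only [value_apply, map_add, map_smul, l.app_map]
  simp [sub_eq_add_neg]

theorem SheafCocone.value_tripleChain (l : SheafCocone F M) (a : Cochain F 1) {x y z : P}
    (h : x < y) (h' : y < z) : l.value (q := 1 + 1) (tripleChain h h') (coboundary F 1 a) =
      l.value (pairChain h') a - l.value (pairChain (h.trans h')) a + l.value (pairChain h) a := by
  rw [value_coboundary_one, tripleChain_face_zero, tripleChain_face_one, tripleChain_face_two]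

end Cocone

/-! ### Coordinates of cochains and their vanishing along rays -/

section Values

variable {d : ℕ}

/-- The coordinates modulo `2`, as a cocone of the sheaf `𝓕¹ ⊗ 𝔽₂`. -/
def coordCocone (S : Set (PointedCone ℝ (Fin d → ℝ))) :
    SheafCocone (multitangentSheaf S 1) (Fin d → ZMod 2) where
  app x := coord (perp x.cone)
  app_map _ a := coord_inclusionMap _ a

/-- The coefficient of `e_i ∧ e_j` modulo `2`, as a cocone of the sheaf `𝓕² ⊗ 𝔽₂`. -/
def coordTwoCocone (S : Set (PointedCone ℝ (Fin d → ℝ))) (i j : Fin d) :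
    SheafCocone (multitangentSheaf S (1 + 1)) (ZMod 2) where
  app x := coordTwo (perp x.cone) i j
  app_map _ a := coordTwo_inclusionMap _ i j a

theorem coordTwoCocone_pairing (S : Set (PointedCone ℝ (Fin d → ℝ))) (i j : Fin d)
    (x : CellPoset S) (a b : (multitangentSheaf S 1).obj x) :
    (coordTwoCocone S i j).app x ((wedgePairing S 1 1).app x a b) =
      (coordCocone S).app x a i * (coordCocone S).app x b j -
      (coordCocone S).app x a j * (coordCocone S).app x b i :=
  coordTwo_wedge _ i j a b

theorem coordTwoCocone_cup (S : Set (PointedCone ℝ (Fin d → ℝ))) (i j : Fin d)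
    (a b : Cochain (multitangentSheaf S 1) 1) {x y z : CellPoset S} (h : x < y) (h' : y < z) :
    (coordTwoCocone S i j).value (q := 1 + 1) (tripleChain h h')
        (cochainCup (wedgePairing S 1 1) 1 1 a b) =
      (coordCocone S).value (pairChain h) a i * (coordCocone S).value (pairChain h') b j -
      (coordCocone S).value (pairChain h) a j * (coordCocone S).value (pairChain h') b i := by
  rw [SheafCocone.value_apply, cochainCup_apply, coordTwoCocone_pairing,
    SheafCocone.app_map, SheafCocone.app_map]
  simp only [← SheafCocone.value_apply, tripleChain_front, tripleChain_back]

theorem coordCocone_injective (x : CellPoset (cubeFan d)) :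
    Function.Injective ((coordCocone (cubeFan d)).app x) :=
  (isCoordinate_perp x.cone_mem).coord_injective

theorem apply_eq_zero_of_mem_perp {x : CellPoset (cubeFan d)} {i : Fin d} {s : ℝ} (hs : s ≠ 0)
    (hi : Pi.single i s ∈ x.cone) {m : Fin d → ℤ} (hm : m ∈ perp x.cone) : m i = 0 := by
  simpa [hs] using hm _ hi

theorem coordCocone_eq_zero {x : CellPoset (cubeFan d)} {i : Fin d} {s : ℝ} (hs : s ≠ 0)
    (hi : Pi.single i s ∈ x.cone) (a : (multitangentSheaf (cubeFan d) 1).obj x) :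
    (coordCocone (cubeFan d)).app x a i = 0 :=
  coord_eq_zero (fun _ hm => apply_eq_zero_of_mem_perp hs hi hm) a

theorem coordTwoCocone_eq_zero {x : CellPoset (cubeFan d)} {i j : Fin d} {s : ℝ} (hs : s ≠ 0)
    (h : Pi.single i s ∈ x.cone ∨ Pi.single j s ∈ x.cone)
    (a : (multitangentSheaf (cubeFan d) (1 + 1)).obj x) :
    (coordTwoCocone (cubeFan d) i j).app x a = 0 :=
  coordTwo_eq_zero (h.imp (fun hi _ hm => apply_eq_zero_of_mem_perp hs hi hm)
    (fun hj _ hm => apply_eq_zero_of_mem_perp hs hj hm)) a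

theorem value_pairChain_eq_zero {x y : CellPoset (cubeFan d)} (h : x < y) {i : Fin d} {s : ℝ}
    (hs : s ≠ 0) (hi : Pi.single i s ∈ y.cone)
    (a : Cochain (multitangentSheaf (cubeFan d) 1) 1) :
    (coordCocone (cubeFan d)).value (pairChain h) a i = 0 :=
  coordCocone_eq_zero (x := pairChain h (Fin.last 1)) hs hi (a (pairChain h))

theorem valueTwo_pairChain_eq_zero {x y : CellPoset (cubeFan d)} (h : x < y) {i j : Fin d}
    {s : ℝ} (hs : s ≠ 0) (hij : Pi.single i s ∈ y.cone ∨ Pi.single j s ∈ y.cone)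
    (a : Cochain (multitangentSheaf (cubeFan d) (1 + 1)) 1) :
    (coordTwoCocone (cubeFan d) i j).value (pairChain h) a = 0 :=
  coordTwoCocone_eq_zero (x := pairChain h (Fin.last 1)) hs hij (a (pairChain h))

/-- Sections of the sheaf `𝓕¹ ⊗ 𝔽₂` over a cell with prescribed coordinates. -/
def ofCoordinates (x : CellPoset (cubeFan d)) (t : Fin d → ZMod 2) :
    (multitangentSheaf (cubeFan d) 1).obj x := ofCoord (perp x.cone) t

theorem coordCocone_ofCoordinates {x : CellPoset (cubeFan d)} {t : Fin d → ZMod 2}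
    (ht : ∀ i, Pi.single i 1 ∈ x.cone ∨ Pi.single i (-1) ∈ x.cone → t i = 0) :
    (coordCocone (cubeFan d)).app x (ofCoordinates x t) = t :=
  coord_ofCoord fun i hi => by
    rw [single_mem_perp_iff x.cone_mem, ← not_or]
    exact fun h => hi (ht i h)

end Values

/-! ### The square of a class -/

section Square

variable {d : ℕ}

theorem neg_one_pow_smul {M : Type*} [AddCommGroup M] [Module (ZMod 2) M] (n : ℕ) (x : M) :
    (-1 : ZMod 2) ^ n • x = x := by
  have h : (-1 : ZMod 2) = 1 := rfl
  rw [h, one_pow, one_smul]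

/-- A family of quadratic refinements of a pairing of a sheaf with itself makes the cup square
of every `1`-cocycle a coboundary. -/
theorem cup_self_eq_coboundary {P : Type*} [PartialOrder P] {F E : PosetSheaf (ZMod 2) P}
    (μ : Pairing F F E) (Q : ∀ x, F.obj x → E.obj x)
    (hmap : ∀ {x y} (h : x ≤ y) (a : F.obj x), Q y (F.map h a) = E.map h (Q x a))
    (hadd : ∀ x (a b : F.obj x), Q x (a + b) = Q x a + Q x b + μ.app x a b)
    {a : Cochain F 1} (ha : coboundary F 1 a = 0) :
    coboundary E 1 (fun c => Q _ (a c)) = cochainCup μ 1 1 a a := by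
  funext c
  have h0 := c.face_last_le 0
  have h1 := c.face_last_le 1
  have h2 := c.face_last_le 2
  have e := cocycle_one F ha h0 h1 h2 le_rfl
  have hf : Chain.front (p := 1) (q := 1) c = c.face 2 := by ext i; fin_cases i <;> rfl
  have hb : Chain.back (p := 1) (q := 1) c = c.face 0 := by ext i; fin_cases i <;> rfl
  rw [coboundary_apply, Fin.sum_univ_three, cochainCup_apply,
    map_congr_chain F a hf _ h2, map_congr_chain F a hb _ h0]
  simp only [neg_one_pow_smul, ← hmap]
  -- The middle face carries the sum of the other two values, so `Q` of it contributes both outer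
  -- terms again, which cancel modulo 2, and the pairing.
  rw [e, add_comm (F.map h0 _), hadd]
  generalize Q _ (F.map h0 (a (c.face 0))) = p
  generalize Q _ (F.map h2 (a (c.face 2))) = q
  have hp : p + p = 0 := by nth_rewrite 1 [← neg_eq_self_of_zmod_two p]; exact neg_add_cancel p
  have hq : q + q = 0 := by nth_rewrite 1 [← neg_eq_self_of_zmod_two q]; exact neg_add_cancel q
  generalize μ.app _ _ _ = r
  calc p + (q + p + r) + q = (p + p) + (q + q) + r := by abel
    _ = r := by rw [hp, hq]; simp

theorem tropicalCup_self (β : tropicalCohomology (cubeFan d) 1 1) :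
    tropicalCup (cubeFan d) β β = 0 := by
  obtain ⟨a, rfl⟩ := Submodule.Quotient.mk_surjective _ β
  rw [tropicalCup, cup_mk, Submodule.Quotient.mk_eq_zero]
  exact ⟨_, cup_self_eq_coboundary (wedgePairing (cubeFan d) 1 1)
    (fun x => quadRefinement (perp x.cone))
    (fun {x _} _ a => quadRefinement_inclusionMap (isCoordinate_perp x.cone_mem) _ a)
    (fun x => quadRefinement_add (isCoordinate_perp x.cone_mem)) a.2⟩

end Square

/-! ### The first cohomology group -/

section FirstCohomology

variable {d : ℕ}

theorem cell_lt_cell {v w : Fin d → ℝ} (h : w ∈ (cell v).cone) (h' : v ∉ (cell w).cone) :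
    cell v < cell w :=
  lt_iff_le_not_ge.2 ⟨le_cell_iff.2 h, fun e => h' (le_cell_iff.1 e)⟩

theorem single_not_mem_cell_zero {i : Fin d} {s : ℝ} (hs : s ≠ 0) :
    Pi.single i s ∉ (cell (0 : Fin d → ℝ)).cone := fun h => by
  simpa [hs] using (mem_cone_cell.1 h i).1 rfl

theorem ray_lt (i : Fin d) {s : ℝ} (hs : s ≠ 0) :
    cell (Pi.single i s : Fin d → ℝ) < cell 0 :=
  cell_lt_cell (cell _).cone.zero_mem (single_not_mem_cell_zero hs)

/-- The coordinates of the value of a `1`-cochain on `x < 0`, where `0` is the open cell. -/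
def topValue (x : CellPoset (cubeFan d)) :
    Cochain (multitangentSheaf (cubeFan d) 1) 1 →ₗ[ZMod 2] (Fin d → ZMod 2) :=
  open Classical in
  if h : x < cell 0 then (coordCocone (cubeFan d)).value (pairChain h) else 0

theorem topValue_of_lt {x : CellPoset (cubeFan d)} (h : x < cell 0) :
    topValue x = (coordCocone (cubeFan d)).value (pairChain h) := dif_pos h

/-- The default value `0` is the right normalisation: it keeps `value_eq_topValue_sub` valid when
`y` is the open cell. -/
theorem topValue_cell_zero : topValue (cell (0 : Fin d → ℝ)) = 0 := dif_neg (lt_irrefl _)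

/-- This is the cocycle condition on `x < y < 0`: in coordinates, `topValue` is a potential for the
cocycle. -/
theorem value_eq_topValue_sub {a : Cochain (multitangentSheaf (cubeFan d) 1) 1}
    (ha : a ∈ cocycles _ 1) {x y : CellPoset (cubeFan d)} (h : x < y) :
    (coordCocone (cubeFan d)).value (pairChain h) a = topValue x a - topValue y a := by
  rcases (le_cell_zero y).lt_or_eq with hy | rfl
  · have e := (coordCocone (cubeFan d)).value_tripleChain a h hy
    rw [show coboundary _ 1 a = 0 from ha, map_zero] at e
    rw [topValue_of_lt hy, topValue_of_lt (h.trans hy)]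
    rw [← sub_eq_zero, e]
    abel
  · rw [topValue_cell_zero, topValue_of_lt h, LinearMap.zero_apply, sub_zero]

/-- Between `x` and the ray the potential changes by a section over the ray's cell, which has no
`i`-th coordinate. -/
theorem topValue_eq_ray {a : Cochain (multitangentSheaf (cubeFan d) 1) 1}
    (ha : a ∈ cocycles _ 1) {x : CellPoset (cubeFan d)} {i : Fin d} {s : ℝ} (hs : s ≠ 0)
    (hx : Pi.single i s ∈ x.cone) : topValue x a i = topValue (cell (Pi.single i s)) a i := by
  rcases (le_cell_iff.2 hx).lt_or_eq with h | rfl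
  · have e := congrFun (value_eq_topValue_sub ha h) i
    rw [value_pairChain_eq_zero h hs (self_mem_cone_cell _)] at e
    exact (sub_eq_zero.1 e.symm)
  · rfl

/-- The `i`-th period of a `1`-cochain: the sum over the two rays spanned by `±e_i` of the `i`-th
coordinate. -/
def period : Cochain (multitangentSheaf (cubeFan d) 1) 1 →ₗ[ZMod 2] (Fin d → ZMod 2) :=
  LinearMap.pi fun i => LinearMap.proj i ∘ₗ
    (topValue (cell (Pi.single i 1)) + topValue (cell (Pi.single i (-1))))

theorem period_apply (a : Cochain (multitangentSheaf (cubeFan d) 1) 1) (i : Fin d) :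
    period a i = topValue (cell (Pi.single i 1)) a i + topValue (cell (Pi.single i (-1))) a i :=
  rfl

/-- The section of `s` over the ray's cell has no `i`-th coordinate, so only the open cell
contributes. The result does not depend on `r`, hence coboundaries have period zero. -/
theorem topValue_ray_coboundary (s : Cochain (multitangentSheaf (cubeFan d) 1) 0) (i : Fin d)
    {r : ℝ} (hr : r ≠ 0) :
    topValue (cell (Pi.single i r)) (coboundary _ 0 s) i =
      (coordCocone (cubeFan d)).value (pointChain (cell 0)) s i := by
  rw [topValue_of_lt (ray_lt i hr), SheafCocone.value_coboundary_zero, Pi.sub_apply]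
  have h1 : (coordCocone (cubeFan d)).value ((pairChain (ray_lt i hr)).face 1) s i = 0 :=
    coordCocone_eq_zero hr (self_mem_cone_cell _) _
  rw [h1, sub_zero, pairChain_face_zero]

theorem period_coboundary (s : Cochain (multitangentSheaf (cubeFan d) 1) 0) :
    period (coboundary _ 0 s) = 0 := by
  ext i
  rw [period_apply, topValue_ray_coboundary s i one_ne_zero,
    topValue_ray_coboundary s i (neg_ne_zero.2 one_ne_zero)]
  exact CharTwo.add_self_eq_zero _

theorem exists_coboundary_eq {a : Cochain (multitangentSheaf (cubeFan d) 1) 1}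
    (ha : a ∈ cocycles _ 1) (hp : period a = 0) : ∃ s, coboundary _ 0 s = a := by
  -- The constant of integration: subtracting the potential from `t` kills the `i`-th coordinate on
  -- cells containing `e_i`, and, by the vanishing of the period, on those containing `-e_i`.
  let t : Fin d → ZMod 2 := fun i => topValue (cell (Pi.single i 1)) a i
  have ht : ∀ x : CellPoset (cubeFan d),
      (coordCocone (cubeFan d)).app x (ofCoordinates x (t - topValue x a)) =
        t - topValue x a := by
    refine fun x => coordCocone_ofCoordinates fun i hi => ?_
    rw [Pi.sub_apply, sub_eq_zero]
    rcases hi with hi | hi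
    · rw [topValue_eq_ray ha one_ne_zero hi]
    · rw [topValue_eq_ray ha (neg_ne_zero.2 one_ne_zero) hi]
      exact CharTwo.add_eq_zero.1 (congrFun hp i)
  refine ⟨fun c => ofCoordinates _ (t - topValue (c (Fin.last 0)) a), ?_⟩
  funext c
  apply coordCocone_injective
  rw [← SheafCocone.value_apply, ← SheafCocone.value_apply, SheafCocone.value_coboundary_zero,
    SheafCocone.value_apply, SheafCocone.value_apply, ht, ht]
  have hc := value_eq_topValue_sub ha (c.strictMono Fin.zero_lt_one)
  rw [← eq_pairChain] at hc
  rw [hc, sub_sub_sub_cancel_left]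
  rfl

open Classical in
theorem exists_period_eq (v : Fin d → ZMod 2) :
    ∃ a ∈ cocycles (multitangentSheaf (cubeFan d) 1) 1, period a = v := by
  -- The prescribed potential: `v i` on the side of `e_i` and `0` elsewhere. It need not take values
  -- in the sheaf, but its differences do.
  let u : CellPoset (cubeFan d) → Fin d → ZMod 2 := fun x i =>
    if Pi.single i 1 ∈ x.cone then v i else 0
  let a : Cochain (multitangentSheaf (cubeFan d) 1) 1 := fun c =>
    ofCoordinates _ (u (c 0) - u (c (Fin.last 1)))
  have ha : ∀ c, (coordCocone (cubeFan d)).value c a = u (c 0) - u (c (Fin.last 1)) := by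
    refine fun c => coordCocone_ofCoordinates fun i hi => ?_
    have hle : (c (Fin.last 1)).cone ≤ (c 0).cone := c.monotone (Fin.zero_le _)
    rw [Pi.sub_apply, sub_eq_zero]
    rcases hi with hi | hi
    · simp only [u, if_pos hi, if_pos (hle hi)]
    · have h : ∀ x : CellPoset (cubeFan d), Pi.single i (-1) ∈ x.cone →
          Pi.single i 1 ∉ x.cone := fun x hx hx' => not_single_neg_mem x.cone_mem hx' hx
      simp only [u, if_neg (h _ hi), if_neg (h _ (hle hi))]
  have htop : ∀ {x} (_ : x < cell 0), topValue x a = u x := by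
    intro x hx
    have h0 : u (cell 0) = 0 := by
      ext i
      exact if_neg (single_not_mem_cell_zero one_ne_zero)
    rw [topValue_of_lt hx, ha]
    change u x - u (cell 0) = u x
    rw [h0, sub_zero]
  refine ⟨a, ?_, ?_⟩
  · change coboundary _ 1 a = 0
    funext c
    apply coordCocone_injective
    refine Eq.trans ?_ (LinearMap.map_zero _).symm
    refine ((coordCocone (cubeFan d)).value_coboundary_one a c).trans ?_
    rw [ha, ha, ha]
    change u (c 1) - u (c 2) - (u (c 0) - u (c 2)) + (u (c 0) - u (c 1)) = 0
    abel
  · ext i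
    rw [period_apply, htop (ray_lt i one_ne_zero), htop (ray_lt i (neg_ne_zero.2 one_ne_zero))]
    have h1 : u (cell (Pi.single i 1)) i = v i := if_pos (self_mem_cone_cell _)
    have h2 : u (cell (Pi.single i (-1))) i = 0 := if_neg fun h =>
      not_single_neg_mem (cell _).cone_mem h (self_mem_cone_cell _)
    rw [h1, h2, add_zero]

/-- The periods of a class in `H¹(𝕋Σ_□, 𝓕¹ ⊗ 𝔽₂)`. -/
def cohomologyPeriod : tropicalCohomology (cubeFan d) 1 1 →ₗ[ZMod 2] (Fin d → ZMod 2) :=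
  Submodule.liftQ _ (period ∘ₗ (cocycles _ 1).subtype) (by
    rintro ⟨a, ha⟩ ⟨s, rfl⟩
    exact period_coboundary s)

theorem cohomologyPeriod_mk (a : cocycles (multitangentSheaf (cubeFan d) 1) 1) :
    cohomologyPeriod (Submodule.Quotient.mk a) = period a.1 := rfl

theorem cohomologyPeriod_bijective :
    Function.Bijective (cohomologyPeriod (d := d)) := by
  constructor
  · rw [← LinearMap.ker_eq_bot, LinearMap.ker_eq_bot']
    intro β hβ
    obtain ⟨a, rfl⟩ := Submodule.Quotient.mk_surjective _ β
    exact (Submodule.Quotient.mk_eq_zero _).2 (exists_coboundary_eq a.2 hβ)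
  · intro v
    obtain ⟨a, ha, rfl⟩ := exists_period_eq v
    exact ⟨Submodule.Quotient.mk ⟨a, ha⟩, rfl⟩

end FirstCohomology

/-! ### The kernel of the cup product with a class -/

section Kernel

variable {d : ℕ}

theorem vertex_lt_ray {i j : Fin d} (hij : i ≠ j) (s : ℝ) {t : ℝ} (ht : t ≠ 0) :
    cell (Pi.single i s + Pi.single j t : Fin d → ℝ) < cell (Pi.single i s) := by
  apply cell_lt_cell
  · refine mem_cone_cell.2 fun l => ?_
    by_cases hl : l = i
    · subst hl; simp [hij, mul_self_nonneg]
    · simp [hl]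
  · intro h
    simpa [hij.symm, ht] using (mem_cone_cell.1 h j).1 (by simp [hij.symm])

theorem single_mem_vertex {i j : Fin d} (hij : i ≠ j) (s t : ℝ) :
    Pi.single j t ∈ (cell (Pi.single i s + Pi.single j t : Fin d → ℝ)).cone := by
  refine mem_cone_cell.2 fun l => ?_
  by_cases hl : l = j
  · subst hl; simp [hij.symm, mul_self_nonneg]
  · simp [hl]

/-- The equation at the chain `vertex < ray < 0` expressing that a cup product is a
coboundary. -/
theorem cup_eq_coboundary_at_flag {a b : Cochain (multitangentSheaf (cubeFan d) 1) 1}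
    (ha : a ∈ cocycles _ 1) {w : Cochain (multitangentSheaf (cubeFan d) (1 + 1)) 1}
    (hw : coboundary _ 1 w = cochainCup (wedgePairing (cubeFan d) 1 1) 1 1 a b)
    {i j : Fin d} (hij : i ≠ j) {s t : ℝ} (hs : s ≠ 0) (ht : t ≠ 0) {k l : Fin d}
    (hkl : k = i ∧ l = j ∨ k = j ∧ l = i) :
    (topValue (cell (Pi.single j t)) a j - topValue (cell (Pi.single i s)) a j) *
        topValue (cell (Pi.single i s)) b i =
      (coordTwoCocone (cubeFan d) k l).value (pairChain (ray_lt i hs)) w +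
      (coordTwoCocone (cubeFan d) k l).value
        (pairChain ((vertex_lt_ray hij s ht).trans (ray_lt i hs))) w := by
  have e := (coordTwoCocone (cubeFan d) k l).value_tripleChain w
    (vertex_lt_ray hij s ht) (ray_lt i hs)
  have e' := coordTwoCocone_cup (cubeFan d) k l a b (vertex_lt_ray hij s ht) (ray_lt i hs)
  -- This value lies over the cell of the ray `s e_i`, where every coefficient involving `e_i`
  -- vanishes; likewise for `h1`, which leaves one term of the minor.
  have h0 : (coordTwoCocone (cubeFan d) k l).value
      (pairChain (vertex_lt_ray hij s ht)) w = 0 := by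
    refine valueTwo_pairChain_eq_zero _ hs ?_ w
    rcases hkl with ⟨rfl, -⟩ | ⟨-, rfl⟩
    · exact Or.inl (self_mem_cone_cell _)
    · exact Or.inr (self_mem_cone_cell _)
  have h1 : (coordCocone (cubeFan d)).value (pairChain (vertex_lt_ray hij s ht)) a i = 0 :=
    value_pairChain_eq_zero _ hs (self_mem_cone_cell _) a
  have h2 : (coordCocone (cubeFan d)).value (pairChain (vertex_lt_ray hij s ht)) a j =
      topValue (cell (Pi.single j t)) a j - topValue (cell (Pi.single i s)) a j := by
    rw [value_eq_topValue_sub ha, Pi.sub_apply, topValue_eq_ray ha ht (single_mem_vertex hij s t)]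
  rw [h0, add_zero, CharTwo.sub_eq_add] at e
  rw [← h2, topValue_of_lt (ray_lt i hs)]
  refine Eq.trans ?_ (e'.symm.trans ((congrArg _ hw.symm).trans e))
  rcases hkl with ⟨rfl, rfl⟩ | ⟨rfl, rfl⟩
  · rw [h1, zero_mul, CharTwo.sub_eq_add, zero_add]
  · rw [h1, zero_mul, sub_zero]

/-- Add the flag equations for the four vertices `±e_i ± e_j` and both rays at each. Every value of
`w` on a pair vertex < 0 or ray < 0 occurs twice and cancels. So do the products taken along a
single ray, while the mixed products assemble into the periods. -/
theorem period_mul_add_eq_zero {a b : Cochain (multitangentSheaf (cubeFan d) 1) 1}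
    (ha : a ∈ cocycles _ 1) {w : Cochain (multitangentSheaf (cubeFan d) (1 + 1)) 1}
    (hw : coboundary _ 1 w = cochainCup (wedgePairing (cubeFan d) 1 1) 1 1 a b)
    {i j : Fin d} (hij : i ≠ j) :
    period a i * period b j + period a j * period b i = 0 := by
  have one : (1 : ℝ) ≠ 0 := one_ne_zero
  have neg : (-1 : ℝ) ≠ 0 := neg_ne_zero.2 one_ne_zero
  have E {s t : ℝ} (hs : s ≠ 0) (ht : t ≠ 0) :=
    cup_eq_coboundary_at_flag ha hw hij hs ht (Or.inl ⟨rfl, rfl⟩)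
  -- The flag through the other ray at the same vertex, with the coefficient still indexed by `(i,
  -- j)` so that the vertex terms match those of `E`.
  have E' {s t : ℝ} (hs : s ≠ 0) (ht : t ≠ 0) :
      (topValue (cell (Pi.single i s)) a i - topValue (cell (Pi.single j t)) a i) *
        topValue (cell (Pi.single j t)) b j =
      (coordTwoCocone (cubeFan d) i j).value (pairChain (ray_lt j ht)) w +
      (coordTwoCocone (cubeFan d) i j).value
        (pairChain ((vertex_lt_ray hij s ht).trans (ray_lt i hs))) w := by
    rw [cup_eq_coboundary_at_flag ha hw hij.symm ht hs (Or.inr ⟨rfl, rfl⟩)]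
    simp only [add_comm (Pi.single j t : Fin d → ℝ) (Pi.single i s)]
  have e1 := E one one
  have e2 := E one neg
  have e3 := E neg one
  have e4 := E neg neg
  have e5 := E' one one
  have e6 := E' one neg
  have e7 := E' neg one
  have e8 := E' neg neg
  simp only [period_apply]
  linear_combination (norm := (ring_nf; reduce_mod_char)) e1 + e2 + e3 + e4 + e5 + e6 + e7 + e8

/-- Over `𝔽₂` a nonzero entry `g k` equals `1`, so the minors with column `k` express `f` as `f k`
times `g`. -/
theorem exists_smul_eq_of_mul_add_eq_zero {f g : Fin d → ZMod 2} (hg : g ≠ 0)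
    (h : ∀ i j, i ≠ j → f i * g j + f j * g i = 0) : ∃ r : ZMod 2, r • g = f := by
  obtain ⟨k, hk⟩ := Function.ne_iff.1 hg
  have hk' : g k = 1 := by
    rw [Pi.zero_apply] at hk
    generalize g k = x at hk
    revert x
    decide
  refine ⟨f k, ?_⟩
  ext i
  rw [Pi.smul_apply, smul_eq_mul]
  by_cases hi : i = k
  · rw [hi, hk', mul_one]
  · have := h i k hi
    rw [hk', mul_one] at this
    exact (CharTwo.add_eq_zero.1 this).symm

section Alternating

variable {H N : Type*} [AddCommGroup H] [Module (ZMod 2) H] [AddCommGroup N] [Module (ZMod 2) N]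
  {B : H →ₗ[ZMod 2] H →ₗ[ZMod 2] N} {f : H →ₗ[ZMod 2] (Fin d → ZMod 2)}

/-- Vanishing minors make the coordinates of a kernel element proportional to those of `D`; the
reverse inclusion is `B D D = 0`. -/
theorem ker_flip_eq_span (hB : ∀ x, B x x = 0) (hf : Function.Injective f)
    (hfB : ∀ x y, B x y = 0 → ∀ i j, i ≠ j → f x i * f y j + f x j * f y i = 0) {D : H}
    (hD : D ≠ 0) : LinearMap.ker (B.flip D) = Submodule.span (ZMod 2) {D} := by
  apply le_antisymm
  · intro β hβ
    have hD' : f D ≠ 0 := fun h => hD (hf (h.trans (map_zero f).symm))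
    obtain ⟨r, hr⟩ := exists_smul_eq_of_mul_add_eq_zero hD' (hfB β D hβ)
    exact Submodule.mem_span_singleton.2 ⟨r, hf ((map_smul f r D).trans hr)⟩
  · rw [Submodule.span_singleton_le_iff_mem]
    exact hB D

/-- Rank–nullity in dimension `n + 1` with a one-dimensional kernel. -/
theorem rank_eq_of_ker_eq_span {n : ℕ} {f : H →ₗ[ZMod 2] (Fin (n + 1) → ZMod 2)}
    (hf : Function.Bijective f) {g : H →ₗ[ZMod 2] N} {D : H} (hD : D ≠ 0)
    (hg : LinearMap.ker g = Submodule.span (ZMod 2) {D}) :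
    LinearMap.rank g = (n : Cardinal) := by
  let e := LinearEquiv.ofBijective f hf
  have : Module.Finite (ZMod 2) H := Module.Finite.equiv e.symm
  have h := LinearMap.finrank_range_add_finrank_ker g
  rw [hg, finrank_span_singleton hD, e.finrank_eq, Module.finrank_fin_fun] at h
  rw [LinearMap.rank, ← Module.finrank_eq_rank, Nat.cast_inj]
  omega

end Alternating

theorem exists_coboundary_eq_cup {P : Type*} [PartialOrder P] {k : Type*} [CommRing k]
    {F G E : PosetSheaf k P} (μ : Pairing F G E) (a : cocycles F 1) (b : cocycles G 1)
    (h : cup μ (Submodule.Quotient.mk a) (Submodule.Quotient.mk b) = 0) :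
    ∃ w, coboundary E 1 w = cochainCup μ 1 1 a.1 b.1 := by
  rw [cup_mk, Submodule.Quotient.mk_eq_zero] at h
  exact h

theorem cohomologyPeriod_mul_add_eq_zero (β D : tropicalCohomology (cubeFan d) 1 1)
    (h : tropicalCup (cubeFan d) β D = 0) (i j : Fin d) (hij : i ≠ j) :
    cohomologyPeriod β i * cohomologyPeriod D j +
      cohomologyPeriod β j * cohomologyPeriod D i = 0 := by
  induction β using Submodule.Quotient.induction_on with | _ a
  induction D using Submodule.Quotient.induction_on with | _ b
  obtain ⟨w, hw⟩ := exists_coboundary_eq_cup (wedgePairing (cubeFan d) 1 1) a b h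
  rw [cohomologyPeriod_mk, cohomologyPeriod_mk]
  exact period_mul_add_eq_zero a.2 hw hij

theorem ker_tropicalCup_flip {D : tropicalCohomology (cubeFan d) 1 1} (hD : D ≠ 0) :
    LinearMap.ker ((tropicalCup (cubeFan d)).flip D) = Submodule.span (ZMod 2) {D} :=
  ker_flip_eq_span tropicalCup_self cohomologyPeriod_bijective.1
    cohomologyPeriod_mul_add_eq_zero hD

theorem rank_tropicalCup_flip {n : ℕ} {D : tropicalCohomology (cubeFan (n + 1)) 1 1}
    (hD : D ≠ 0) : LinearMap.rank ((tropicalCup (cubeFan (n + 1))).flip D) = (n : Cardinal) :=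
  rank_eq_of_ker_eq_span cohomologyPeriod_bijective hD (ker_tropicalCup_flip hD)

end Kernel

end TropicalCube
end

theorem mainTheorem11 (n : ℕ) :
    (∀ β : TropicalCube.tropicalCohomology (TropicalCube.cubeFan (n + 1)) 1 1,
      TropicalCube.tropicalCup (TropicalCube.cubeFan (n + 1)) β β = 0) ∧
    ∀ D : TropicalCube.tropicalCohomology (TropicalCube.cubeFan (n + 1)) 1 1, D ≠ 0 →
      LinearMap.ker ((TropicalCube.tropicalCup (TropicalCube.cubeFan (n + 1))).flip D) =
          Submodule.span (ZMod 2) {D} ∧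
        LinearMap.rank ((TropicalCube.tropicalCup (TropicalCube.cubeFan (n + 1))).flip D) =
          (n : Cardinal) :=
  ⟨TropicalCube.tropicalCup_self, fun _ hD =>
    ⟨TropicalCube.ker_tropicalCup_flip hD, TropicalCube.rank_tropicalCup_flip hD⟩⟩
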